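/- Consider a connected network with $n\ge 2$ nodes and diameter $D$, and $k\ge 1$ tokens, each a binary string of length $L$, distributed among the nodes in an arbitrary way (every node holds a possibly empty multiset of tokens). The network is anonymous and synchronous: all nodes run the same algorithm, each node labels its incident edges locally and arbitrarily by $1,\dots,\deg(v)$, and initially a node knows only its degree, its own tokens, and one global number, which is, for all nodes, either the exact value of $n$ or the exact value of $k$ (and it is known which of the two is given). In the token collision problem every node has to halt and output whether some two of the $k$ tokens (at the same node or at different nodes) have equal value. There is a deterministic algorithm that solves token collision on all such networks and inputs and has the following property: for every constant $c$ there is a constant $C$, depending only on $c$, such that whenever $L\le c\log_2 n$, every message sent through an edge in a round has at most $C\log_2 n$ bits (the CONGEST model), and after at most $C\,(D+k\cdot L/\log_2 n)$ rounds all nodes have halted with the correct answer. In short: if $L=O(\log n)$ and every node knows the exact value of $n$ or of $k$, token collision is solved deterministically in $O(D+k\cdot L/\log n)$ rounds of the anonymous CONGEST model. -/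

import Mathlib

namespace TokenCollision

/-- A token is a binary string. -/
abbrev Token : Type := List Bool

/-- A message is a binary string; the empty string stands for sending nothing. -/
abbrev Message : Type := List Bool

/-- The global knowledge that all nodes are given: either the exact number of nodes,
or the exact number of tokens. -/
inductive Knowledge : Type
  | nodes (n : ℕ) : Knowledge
  | tokens (k : ℕ) : Knowledge

/-- A connected network on the vertex set `V`. Each node `v` labels its incident edges with
the local labels in `Fin (deg v)`: `port v i` is the neighbour at the other end of the edge that
`v` labels `i`. (As `port v` is a bijection, `deg v` is the degree of `v`.) The labels at the two
ends of an edge are unrelated. -/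
structure Network (V : Type) where
  graph : SimpleGraph V
  connected : graph.Connected
  deg : V → ℕ
  port : (v : V) → Fin (deg v) ≃ graph.neighborSet v

/-- A deterministic synchronous message-passing algorithm for anonymous networks. All nodes run
the same algorithm. A node of degree `d` starts in a state that depends only on the global
knowledge, on `d` and on its own collection of input tokens. In each round it sends one message
through each incident edge, receives one message through each incident edge, and changes its
state. A node whose state has output `some b` has halted with result `b`. -/
structure Algorithm where
  State : ℕ → Type
  init : Knowledge → (d : ℕ) → Multiset Token → State d
  send : {d : ℕ} → State d → Fin d → Message
  receive : {d : ℕ} → State d → (Fin d → Message) → State d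
  output : {d : ℕ} → State d → Option Bool

/-- The message that a node in state `s` sends through its edge `i`; a halted node sends
nothing. -/
def Algorithm.outgoing (A : Algorithm) {d : ℕ} (s : A.State d) (i : Fin d) : Message :=
  match A.output s with
  | none => A.send s i
  | some _ => []

/-- The state after a round in which the messages `m` were received; a halted node keeps its
state (and hence its result) forever. -/
def Algorithm.next (A : Algorithm) {d : ℕ} (s : A.State d) (m : Fin d → Message) : A.State d :=
  match A.output s with
  | none => A.receive s m
  | some _ => s

variable {V : Type}

/-- The label that the other endpoint uses for the edge that `v` labels `i`. -/
def Network.backPort (N : Network V) (v : V) (i : Fin (N.deg v)) :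
    Fin (N.deg (N.port v i : V)) :=
  (N.port (N.port v i : V)).symm ⟨v, (N.port v i).2.symm⟩

/-- The states of all nodes after `t` rounds, on the input `x`. -/
def Algorithm.run (A : Algorithm) (N : Network V) (κ : Knowledge) (x : V → Multiset Token) :
    ℕ → (v : V) → A.State (N.deg v)
  | 0 => fun v => A.init κ (N.deg v) (x v)
  | t + 1 => fun v => A.next (A.run N κ x t v)
      fun i => A.outgoing (A.run N κ x t (N.port v i : V)) (N.backPort v i)

/-- Every message sent in the execution on input `x` has at most `B` bits. -/
def Algorithm.RespectsBandwidth (A : Algorithm) (N : Network V) (κ : Knowledge)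
    (x : V → Multiset Token) (B : ℝ) : Prop :=
  ∀ (t : ℕ) (v : V) (i : Fin (N.deg v)), ((A.outgoing (A.run N κ x t v) i).length : ℝ) ≤ B

variable [Fintype V]

/-- The total number of tokens, counted with multiplicity. -/
def numTokens (x : V → Multiset Token) : ℕ := ∑ v, Multiset.card (x v)

/-- Two of the tokens (at the same node or at different nodes) have the same value. -/
def HasCollision (x : V → Multiset Token) : Prop := ¬ (∑ v, x v).Nodup

/-- After at most `R` rounds all nodes have halted, and each of them has returned the correct
answer: `true` if there are no colliding tokens, and `false` if there are. -/
def Algorithm.SolvesWithin (A : Algorithm) (N : Network V) (κ : Knowledge)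
    (x : V → Multiset Token) (R : ℝ) : Prop :=
  ∃ T : ℕ, (T : ℝ) ≤ R ∧
    ∀ v, ∃ b : Bool, A.output (A.run N κ x T v) = some b ∧ (b = true ↔ ¬ HasCollision x)

end TokenCollision

/-!
Every node codes its tokens as numbers and starts the wave of its smallest one; a node always
belongs to the best wave that it has heard of, at the distance that the wave has travelled
(`IsWave`). A parent pointer towards distance zero turns each wave into a forest, and an echo tells
a root that all nodes around its tree are in the same wave and that the nodes of the tree have
finished. Along the tree the root sums up the numbers of nodes and of tokens (`IsCount`).

The point is that the global number, be it `n` or `k`, lets a root see whether it is alone. If its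
count is exact, then no other node can have started the same wave, since that node and its tokens
would be missing in the count (`IsCount.count_root_add_le`); so the wave covers the network, its
token is the smallest one, all counts are exact, and all distances from the root are less than the
elapsed time (`leads_of_accepts`). If there is no collision, then a done root is alone in its wave,
so that its count is exact; hence a wrong count proves a collision (`hasCollision_of_not_accepts`).
It is met by an alarm, which spreads to all nodes and ends the execution. So is a count of
tokens above the code of the token, hence above the number of strings of its length; this keeps the
final phase short when the strings are empty. The roots of the smallest token are done by time
`2 D + 1` (`rootDone_of_min`), so that one of the two cases arises in time.

A root that accepts, at time `s`, announces `s`, the number of tokens and the number `B` of tokens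
that fit into `O(log n)` bits; it knows `n` by now, even if `k` was given. Everybody has heard of
it by time `2 s`. From then on all nodes flood the tokens, in each round `B` that they have not sent
before. Pipelining (`IsFlood.known_within`) makes all tokens known to all nodes after `2 s + k / B`
further rounds, as all distances are at most `2 s`. At that moment, which they can compute from the
announcement, all nodes halt and compare the number of distinct tokens with the number of tokens.

The analysis is made for the execution `ideal` in which alarms are ignored; the actual one agrees
with it at all nodes that do not know of an alarm (`coupled`), and alarms are never false.
-/

namespace TokenCollision

/-! ### Numbers and bit strings -/

/-- A token as a positive number: its bits below a leading one. The position of the leading one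
remembers the length of the token. -/
def tokenCode : Token → ℕ
  | [] => 1
  | b :: l => Nat.bit b (tokenCode l)

lemma tokenCode_bounds (l : Token) :
    2 ^ l.length ≤ tokenCode l ∧ tokenCode l < 2 ^ (l.length + 1) := by
  induction l with
  | nil => simp [tokenCode]
  | cons b l ih =>
    simp only [tokenCode, List.length_cons, Nat.bit_val]
    have := Bool.toNat_le b
    rw [pow_succ] at *
    rw [pow_succ]
    omega

lemma tokenCode_pos (l : Token) : 0 < tokenCode l :=
  lt_of_lt_of_le (by positivity) (tokenCode_bounds l).1

lemma tokenCode_injective : Function.Injective tokenCode := by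
  intro l
  induction l with
  | nil =>
    intro l' h
    cases l' with
    | nil => rfl
    | cons b l' =>
      have := tokenCode_pos l'
      simp only [tokenCode, Nat.bit_val] at h
      omega
  | cons b l ih =>
    intro l' h
    cases l' with
    | nil =>
      have := tokenCode_pos l
      simp only [tokenCode, Nat.bit_val] at h
      omega
    | cons b' l' =>
      simp only [tokenCode] at h
      simp only [Nat.bit_val] at h
      have h1 := Bool.toNat_le b
      have h2 := Bool.toNat_le b'
      have hb : b.toNat = b'.toNat := by omega
      rw [ih (show tokenCode l = tokenCode l' by omega)]
      cases b <;> cases b' <;> simp_all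

/-- Self-delimiting bit string of a list of bits: every bit is announced by `true`, and the end
by `false`. -/
def delimit : List Bool → Message
  | [] => [false]
  | b :: l => true :: b :: delimit l

lemma length_delimit (l : List Bool) : (delimit l).length = 2 * l.length + 1 := by
  induction l with
  | nil => rfl
  | cons b l ih => simp only [delimit, List.length_cons, ih]; ring

lemma delimit_append_inj {l l' : List Bool} {r r' : Message}
    (h : delimit l ++ r = delimit l' ++ r') : l = l' ∧ r = r' := by
  induction l generalizing l' with
  | nil => cases l' <;> simp_all [delimit]
  | cons b l ih =>
    cases l' with
    | nil => simp [delimit] at h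
    | cons b' l' =>
      simp only [delimit, List.cons_append, List.cons.injEq, true_and] at h
      obtain ⟨h1, h2⟩ := ih h.2
      exact ⟨by rw [h.1, h1], h2⟩

lemma bits_injective : Function.Injective Nat.bits := by
  intro m n h
  refine Nat.eq_of_testBit_eq fun i => ?_
  rw [Nat.testBit_eq_inth, Nat.testBit_eq_inth, h]

/-- A list of numbers as a bit string. -/
def encodeList : List ℕ → Message
  | [] => []
  | n :: l => delimit n.bits ++ encodeList l

lemma encodeList_injective : Function.Injective encodeList := by
  intro l
  induction l with
  | nil =>
    intro l' h
    cases l' with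
    | nil => rfl
    | cons n l' =>
      have := congrArg List.length h
      simp only [encodeList, List.length_append, length_delimit, List.length_nil] at this
      omega
  | cons n l ih =>
    intro l' h
    cases l' with
    | nil =>
      have := congrArg List.length h
      simp [encodeList, length_delimit] at this
    | cons n' l' =>
      obtain ⟨h1, h2⟩ := delimit_append_inj h
      rw [bits_injective h1, ih h2]

lemma length_encodeList (l : List ℕ) :
    (encodeList l).length = (l.map fun n => 2 * n.size + 1).sum := by
  induction l with
  | nil => rfl
  | cons n l ih => simp [encodeList, length_delimit, ih, Nat.size_eq_bits_len]

/-! ### Labels -/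

/-- A label is either `⊤` (no token heard of yet) or a pair of a token code and a distance.
Labels are compared lexicographically. -/
abbrev Label : Type := WithTop (ℕ ×ₗ ℕ)

/-- The label of a node at distance `d` from a holder of the token `a`. -/
def wave (a d : ℕ) : Label := ((toLex (a, d) : ℕ ×ₗ ℕ) : WithTop (ℕ ×ₗ ℕ))

/-- The label with the distance increased by one. -/
def Label.succ : Label → Label :=
  WithTop.map fun p => toLex ((ofLex p).1, (ofLex p).2 + 1)

/-- The token of a label (zero for the label `⊤`). -/
def Label.token (b : Label) : ℕ := (ofLex (b.untopD (toLex (0, 0)))).1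

/-- The distance of a label (zero for the label `⊤`). -/
def Label.distance (b : Label) : ℕ := (ofLex (b.untopD (toLex (0, 0)))).2

lemma label_cases (b : Label) : b = ⊤ ∨ ∃ a d, b = wave a d := by
  induction b using WithTop.recTopCoe with
  | top => exact Or.inl rfl
  | coe p => exact Or.inr ⟨(ofLex p).1, (ofLex p).2, rfl⟩

@[simp] lemma token_wave (a d : ℕ) : (wave a d).token = a := rfl

@[simp] lemma distance_wave (a d : ℕ) : (wave a d).distance = d := rfl

@[simp] lemma wave_ne_top (a d : ℕ) : wave a d ≠ ⊤ := WithTop.coe_ne_top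

@[simp] lemma top_ne_wave (a d : ℕ) : (⊤ : Label) ≠ wave a d := WithTop.top_ne_coe

@[simp] lemma wave_inj {a d a' d' : ℕ} : wave a d = wave a' d' ↔ a = a' ∧ d = d' := by
  constructor
  · intro h
    exact ⟨congrArg Label.token h, congrArg Label.distance h⟩
  · rintro ⟨rfl, rfl⟩
    rfl

@[simp] lemma succ_wave (a d : ℕ) : (wave a d).succ = wave a (d + 1) := rfl

@[simp] lemma succ_top : (⊤ : Label).succ = ⊤ := rfl

lemma wave_le_wave {a d a' d' : ℕ} : wave a d ≤ wave a' d' ↔ a < a' ∨ a = a' ∧ d ≤ d' := by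
  unfold wave
  rw [WithTop.coe_le_coe, Prod.Lex.toLex_le_toLex]

lemma succ_mono {b c : Label} (h : b ≤ c) : b.succ ≤ c.succ := by
  rcases label_cases c with rfl | ⟨a', d', rfl⟩
  · simp
  rcases label_cases b with rfl | ⟨a, d, rfl⟩
  · simp at h
  · rw [succ_wave, succ_wave, wave_le_wave]
    rw [wave_le_wave] at h
    omega

lemma succ_eq_wave {b : Label} {a d : ℕ} (h : b.succ = wave a d) :
    ∃ e, d = e + 1 ∧ b = wave a e := by
  rcases label_cases b with rfl | ⟨a', d', rfl⟩
  · simp at h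
  · rw [succ_wave, wave_inj] at h
    exact ⟨d', h.2.symm, by rw [h.1]⟩

/-! ### Competing waves -/

open Finset

/-- The labelling process on a graph. A node with tokens starts the wave of its smallest token,
and every node joins, in each round anew, the best wave offered by itself and by its neighbours.
A node is done when all its neighbours are in the same wave and those one step further away are
done. -/
structure IsWave {V : Type} (G : SimpleGraph V) (own : V → Label) (label : ℕ → V → Label)
    (parent : ℕ → V → Option V) (done : ℕ → V → Prop) : Prop where
  own_eq : ∀ v, own v = ⊤ ∨ ∃ a, own v = wave a 0
  label_zero : ∀ v, label 0 v = own v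
  label_le_own : ∀ t v, label t v ≤ own v
  label_le : ∀ t v w, G.Adj v w → label (t + 1) v ≤ (label t w).succ
  label_cases : ∀ t v, label (t + 1) v = own v ∨
    ∃ w, G.Adj v w ∧ label (t + 1) v = (label t w).succ
  parent_spec : ∀ t v w, parent (t + 1) v = some w → G.Adj v w ∧ label (t + 1) v = (label t w).succ
  parent_exists : ∀ t v, (∃ w, G.Adj v w ∧ label (t + 1) v = (label t w).succ) →
    ∃ w, parent (t + 1) v = some w
  done_zero : ∀ v, ¬ done 0 v
  done_succ : ∀ t v, done (t + 1) v ↔ ∃ a d, label (t + 1) v = wave a d ∧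
    ∀ w, G.Adj v w → (∃ e, label t w = wave a e) ∧ (label t w = wave a (d + 1) → done t w)

/-- The distance of `v` to the closest node that starts the wave of the token `a` (zero if there
is none). -/
noncomputable def depth {V : Type} (G : SimpleGraph V) (own : V → Label) (a : ℕ) (v : V) : ℕ :=
  sInf ((fun u => G.dist u v) '' {u | own u = wave a 0})

section Depth

variable {V : Type} {G : SimpleGraph V} {own : V → Label}

lemma depth_le {a : ℕ} {u : V} (hu : own u = wave a 0) (v : V) :
    depth G own a v ≤ G.dist u v := Nat.sInf_le ⟨u, hu, rfl⟩

lemma exists_dist_eq_depth {a : ℕ} {u : V} (hu : own u = wave a 0) (v : V) :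
    ∃ w, own w = wave a 0 ∧ G.dist w v = depth G own a v := by
  obtain ⟨w, hw, h⟩ := Nat.sInf_mem (s := (fun u => G.dist u v) '' {u | own u = wave a 0})
    ⟨_, u, hu, rfl⟩
  exact ⟨w, hw, h⟩

lemma depth_eq_dist {a : ℕ} {u : V} (hu : own u = wave a 0)
    (huniq : ∀ w, own w = wave a 0 → w = u) (v : V) : depth G own a v = G.dist u v := by
  obtain ⟨w, hw, h⟩ := exists_dist_eq_depth (G := G) hu v
  rw [← h, huniq w hw]

lemma depth_self {a : ℕ} {u : V} (hu : own u = wave a 0) : depth G own a u = 0 := by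
  have := depth_le (G := G) hu u
  rw [SimpleGraph.dist_self] at this
  omega

end Depth

namespace IsWave

variable {V : Type} {G : SimpleGraph V} {own : V → Label} {label : ℕ → V → Label}
  {parent : ℕ → V → Option V} {done : ℕ → V → Prop}

lemma label_le_of_walk (h : IsWave G own label parent done) {v u : V} {a : ℕ}
    (hu : own u = wave a 0) (p : G.Walk v u) :
    ∀ t, p.length ≤ t → label t v ≤ wave a p.length := by
  induction p with
  | nil =>
    intro t _
    rw [SimpleGraph.Walk.length_nil, ← hu]
    exact h.label_le_own t _
  | cons hadj p ih =>
    intro t ht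
    rw [SimpleGraph.Walk.length_cons] at ht
    obtain ⟨t, rfl⟩ : ∃ s, t = s + 1 := ⟨t - 1, by omega⟩
    exact (h.label_le t _ _ hadj).trans (succ_mono (ih hu t (by omega)))

lemma label_le_of_dist (h : IsWave G own label parent done) (hG : G.Connected) {v u : V} {a t : ℕ}
    (hu : own u = wave a 0) (ht : G.dist u v ≤ t) : label t v ≤ wave a (G.dist u v) := by
  obtain ⟨p, hp⟩ := hG.exists_walk_length_eq_dist v u
  rw [SimpleGraph.dist_comm, ← hp] at ht ⊢
  exact h.label_le_of_walk hu p t ht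

lemma exists_of_label (h : IsWave G own label parent done) (hG : G.Connected) {a d t : ℕ} {v : V}
    (hl : label t v = wave a d) : d ≤ t ∧ ∃ u, own u = wave a 0 ∧ G.dist u v ≤ d := by
  have key : ∀ {t : ℕ} {v : V} {d : ℕ}, own v = wave a d →
      d ≤ t ∧ ∃ u, own u = wave a 0 ∧ G.dist u v ≤ d := by
    intro t v d ho
    rcases h.own_eq v with h' | ⟨b, h'⟩
    · simp [h'] at ho
    · have h2 := ho
      rw [h', wave_inj] at h2
      obtain ⟨rfl, rfl⟩ := h2
      exact ⟨Nat.zero_le _, v, ho, by simp⟩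
  induction t generalizing d v with
  | zero => exact key (by rw [← hl, h.label_zero])
  | succ t ih =>
    rcases h.label_cases t v with h' | ⟨w, hw, h'⟩
    · exact key (by rw [← hl, h'])
    · obtain ⟨e, rfl, he⟩ := succ_eq_wave (h'.symm.trans hl)
      obtain ⟨h1, u, hu, h2⟩ := ih he
      refine ⟨by omega, u, hu, ?_⟩
      have h3 := hG.dist_triangle (u := u) (v := w) (w := v)
      have h4 : G.dist w v = 1 := SimpleGraph.dist_eq_one_iff_adj.2 hw.symm
      omega

/-- In the wave of a token, the label is correct from the start: a node joins the wave with its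
final distance. -/
lemma label_eq_depth (h : IsWave G own label parent done) (hG : G.Connected) {a d t : ℕ} {v : V}
    (hl : label t v = wave a d) : d = depth G own a v := by
  obtain ⟨h1, u, hu, h2⟩ := h.exists_of_label hG hl
  have h3 := depth_le (G := G) hu v
  obtain ⟨w, hw, h4⟩ := exists_dist_eq_depth (G := G) hu v
  have h5 := h.label_le_of_dist hG (v := v) (t := t) hw (by omega)
  rw [hl, wave_le_wave, h4] at h5
  omega

lemma own_of_label_zero (h : IsWave G own label parent done) {a t : ℕ} {v : V}
    (hl : label t v = wave a 0) : own v = wave a 0 := by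
  cases t with
  | zero => rw [← hl, h.label_zero]
  | succ t =>
    rcases h.label_cases t v with h' | ⟨w, hw, h'⟩
    · rw [← hl, h']
    · obtain ⟨e, he, _⟩ := succ_eq_wave (h'.symm.trans hl)
      omega

/-- The wave of the smallest token reaches everybody. -/
lemma label_of_min (h : IsWave G own label parent done) (hG : G.Connected) {m D t : ℕ} {r : V}
    (hr : own r = wave m 0) (hmin : ∀ u, wave m 0 ≤ own u) (hD : ∀ u v, G.dist u v ≤ D)
    (ht : D ≤ t) (v : V) : label t v = wave m (depth G own m v) := by
  have h1 := h.label_le_of_dist hG (v := v) hr ((hD r v).trans ht)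
  rcases TokenCollision.label_cases (label t v) with h2 | ⟨a, d, h2⟩
  · rw [h2] at h1; simp at h1
  obtain ⟨h3, u, hu, h4⟩ := h.exists_of_label hG h2
  have h5 := hmin u
  rw [hu, wave_le_wave] at h5
  rw [h2, wave_le_wave] at h1
  have : a = m := by omega
  subst this
  rw [h2, h.label_eq_depth hG h2]

/-- In the wave of the smallest token all nodes become done. -/
lemma done_of_min (h : IsWave G own label parent done) (hG : G.Connected) {m D : ℕ} {r : V}
    (hr : own r = wave m 0) (hmin : ∀ u, wave m 0 ≤ own u) (hD : ∀ u v, G.dist u v ≤ D) (j : ℕ) :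
    ∀ v t, D ≤ depth G own m v + j → D + 1 + j ≤ t → done t v := by
  induction j with
  | zero =>
    intro v t hv ht
    obtain ⟨t, rfl⟩ : ∃ s, t = s + 1 := ⟨t - 1, by omega⟩
    refine (h.done_succ t v).2 ⟨m, _, h.label_of_min hG hr hmin hD (by omega) v, ?_⟩
    intro w hw
    have h1 := h.label_of_min hG hr hmin hD (show D ≤ t by omega) w
    refine ⟨⟨_, h1⟩, fun h2 => ?_⟩
    rw [h1, wave_inj] at h2
    have := depth_le (G := G) hr w
    have := hD r w
    omega
  | succ j ih =>
    intro v t hv ht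
    obtain ⟨t, rfl⟩ : ∃ s, t = s + 1 := ⟨t - 1, by omega⟩
    refine (h.done_succ t v).2 ⟨m, _, h.label_of_min hG hr hmin hD (by omega) v, ?_⟩
    intro w hw
    have h1 := h.label_of_min hG hr hmin hD (show D ≤ t by omega) w
    refine ⟨⟨_, h1⟩, fun h2 => ?_⟩
    rw [h1, wave_inj] at h2
    exact ih w t (by omega) (by omega)

/-- If a root whose token no other node has as its smallest one is done, then its wave has covered
the whole network, each node being done in time. -/
lemma covered_of_done (h : IsWave G own label parent done) (hG : G.Connected) {a t : ℕ} {r : V}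
    (hl : label t r = wave a 0) (hd : done t r) (huniq : ∀ w, own w = wave a 0 → w = r) (j : ℕ) :
    ∀ v, G.dist r v = j → j < t ∧ label (t - j) v = wave a j ∧ done (t - j) v := by
  have hr := h.own_of_label_zero hl
  induction j with
  | zero =>
    intro v hv
    obtain rfl := (hG.dist_eq_zero_iff).1 hv
    refine ⟨Nat.pos_of_ne_zero ?_, hl, hd⟩
    -- Nobody is done at time zero, which bounds the distances by the elapsed time.
    rintro rfl
    exact h.done_zero _ hd
  | succ j ih =>
    intro v hv
    obtain ⟨w, hw, hwd⟩ : ∃ w, G.Adj w v ∧ G.dist r w = j := by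
      obtain ⟨p, hp⟩ := hG.exists_walk_length_eq_dist v r
      cases p with
      | nil => simp at hv
      | @cons _ w _ hadj q =>
        rw [SimpleGraph.Walk.length_cons, SimpleGraph.dist_comm] at hp
        have h1 := SimpleGraph.dist_le q.reverse
        rw [SimpleGraph.Walk.length_reverse] at h1
        have h2 := hG.dist_triangle (u := r) (v := w) (w := v)
        have h3 : G.dist w v = 1 := SimpleGraph.dist_eq_one_iff_adj.2 hadj.symm
        exact ⟨w, hadj.symm, by omega⟩
    obtain ⟨h1, h2, h3⟩ := ih w hwd
    obtain ⟨s, hs⟩ : ∃ s, t - j = s + 1 := ⟨t - j - 1, by omega⟩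
    rw [hs] at h2 h3
    obtain ⟨a', d', h4, h5⟩ := (h.done_succ s w).1 h3
    rw [h2, wave_inj] at h4
    obtain ⟨rfl, rfl⟩ := h4
    obtain ⟨⟨e, he⟩, h6⟩ := h5 v hw
    have h7 := h.label_eq_depth hG he
    rw [depth_eq_dist hr huniq, hv] at h7
    subst h7
    have hs' : t - (j + 1) = s := by omega
    rw [hs']
    refine ⟨Nat.lt_of_not_le fun hle => ?_, he, h6 he⟩
    have : s = 0 := by omega
    subst this
    exact h.done_zero _ (h6 he)

lemma min_of_done (h : IsWave G own label parent done) (hG : G.Connected) {a t : ℕ} {r : V}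
    (hl : label t r = wave a 0) (hd : done t r) (huniq : ∀ w, own w = wave a 0 → w = r) (v : V) :
    wave a 0 ≤ own v := by
  obtain ⟨_, h2, _⟩ := h.covered_of_done hG hl hd huniq _ v rfl
  have h3 := h.label_le_own (t - G.dist r v) v
  rw [h2] at h3
  rcases h.own_eq v with h4 | ⟨b, h4⟩
  · simp [h4]
  · rw [h4, wave_le_wave] at h3 ⊢
    omega

end IsWave

/-! ### Counting along a wave -/

open Classical in
/-- The process that adds up the weights `f` towards the roots: each node adds to its own weight
the latest sums of its children in the wave. -/
structure IsCount {V : Type} [Fintype V] (G : SimpleGraph V) (label : ℕ → V → Label)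
    (parent : ℕ → V → Option V) (f : V → ℕ) (count : ℕ → V → ℕ) : Prop where
  zero : ∀ v, count 0 v = f v
  succ : ∀ t v, count (t + 1) v = f v + ∑ w, if G.Adj v w ∧ parent t w = some v ∧
    ∃ a d, label (t + 1) v = wave a d ∧ label t w = wave a (d + 1) then count t w else 0

namespace IsCount

variable {V : Type} [Fintype V] {G : SimpleGraph V} {own : V → Label} {label : ℕ → V → Label}
  {parent : ℕ → V → Option V} {done : ℕ → V → Prop} {f : V → ℕ} {count : ℕ → V → ℕ}

open Classical in
/-- The sums at distance `d` count every weight at most once, and only weights at distance at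
least `d`: a node has at most one parent, and its distance in a wave never changes. -/
lemma sum_count_le (hc : IsCount G label parent f count) (h : IsWave G own label parent done)
    (hG : G.Connected) (a t : ℕ) :
    ∀ d, ∑ v with label t v = wave a d, count t v ≤ ∑ v with d ≤ depth G own a v, f v := by
  induction t with
  | zero =>
    intro d
    simp only [hc.zero]
    refine sum_le_sum_of_subset fun v => ?_
    simp only [mem_filter, mem_univ, true_and]
    intro hv
    exact (h.label_eq_depth hG hv).le
  | succ t ih =>
    intro d
    simp only [hc.succ, sum_add_distrib]
    have h1 : ∑ v with label (t + 1) v = wave a d, f v ≤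
        ∑ v with d = depth G own a v, f v := by
      refine sum_le_sum_of_subset fun v => ?_
      simp only [mem_filter, mem_univ, true_and]
      exact h.label_eq_depth hG
    have h2 : ∑ v with label (t + 1) v = wave a d, (∑ w, if G.Adj v w ∧ parent t w = some v ∧
        ∃ a d, label (t + 1) v = wave a d ∧ label t w = wave a (d + 1) then count t w else 0) ≤
        ∑ w with label t w = wave a (d + 1), count t w := by
      rw [sum_comm, sum_filter]
      refine sum_le_sum fun w _ => ?_
      split_ifs with hw
      · cases hp : parent t w with
        | none => simp
        | some u =>
          calc _ ≤ ∑ v with label (t + 1) v = wave a d, if v = u then count t w else 0 := by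
                refine sum_le_sum fun v _ => ?_
                by_cases hvu : v = u
                · rw [if_pos hvu]
                  split_ifs <;> simp
                · rw [if_neg]
                  · simp
                  · rintro ⟨-, h3, -⟩
                    exact hvu (Option.some_injective _ h3).symm
            _ ≤ ∑ v, if v = u then count t w else 0 := sum_le_sum_of_subset (filter_subset _ _)
            _ = count t w := by simp
      · refine le_of_eq (sum_eq_zero fun v hv => if_neg ?_)
        rintro ⟨-, -, a', d', h3, h4⟩
        rw [(mem_filter.1 hv).2, wave_inj] at h3
        exact hw (by rw [h4, h3.1, h3.2])
    have h3 : ∑ v with d ≤ depth G own a v, f v =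
        ∑ v with d = depth G own a v, f v + ∑ v with d + 1 ≤ depth G own a v, f v := by
      rw [← sum_union]
      · congr 1
        ext v
        simp only [mem_filter, mem_univ, true_and, mem_union]
        omega
      · rw [disjoint_filter]
        intro v _ h4
        omega
    have := ih (d + 1)
    omega

open Classical in
/-- A root misses the weight of every other node that starts the same wave. -/
lemma count_root_le (hc : IsCount G label parent f count) (h : IsWave G own label parent done)
    (hG : G.Connected) {a t : ℕ} {r : V} (hl : label t r = wave a 0) :
    count t r ≤ f r + ∑ v with 1 ≤ depth G own a v, f v := by
  cases t with
  | zero => rw [hc.zero]; omega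
  | succ t =>
    rw [hc.succ]
    refine Nat.add_le_add_left (le_trans ?_ (hc.sum_count_le h hG a t 1)) _
    rw [sum_filter]
    refine sum_le_sum fun w _ => ?_
    split_ifs with h1 h2 <;> try simp
    obtain ⟨-, -, a', d', h3, h4⟩ := h1
    rw [hl, wave_inj] at h3
    exact absurd (by rw [h4, h3.1, ← h3.2]) h2

lemma count_root_add_le (hc : IsCount G label parent f count)
    (h : IsWave G own label parent done) (hG : G.Connected) {a t : ℕ} {r u : V}
    (hl : label t r = wave a 0) (hu : own u = wave a 0) (hur : u ≠ r) :
    count t r + f u ≤ ∑ v, f v := by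
  classical
  have h1 := hc.count_root_le h hG hl
  have hr := h.own_of_label_zero hl
  calc count t r + f u ≤ (f u + f r) + ∑ v with 1 ≤ depth G own a v, f v := by omega
    _ = ∑ v ∈ {u, r}, f v + ∑ v with 1 ≤ depth G own a v, f v := by rw [sum_pair hur]
    _ = ∑ v ∈ {u, r} ∪ ({v | 1 ≤ depth G own a v} : Finset V), f v := by
        rw [sum_union]
        rw [disjoint_left]
        intro v hv hv'
        simp only [mem_insert, mem_singleton, mem_filter, mem_univ, true_and] at hv hv'
        rcases hv with rfl | rfl
        · rw [depth_self hu] at hv'; omega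
        · rw [depth_self hr] at hv'; omega
    _ ≤ ∑ v, f v := sum_le_sum_of_subset (subset_univ _)

lemma count_le (hc : IsCount G label parent f count) (h : IsWave G own label parent done)
    (hG : G.Connected) (t : ℕ) (v : V) : count t v ≤ ∑ u, f u := by
  classical
  rcases TokenCollision.label_cases (label t v) with h1 | ⟨a, d, h1⟩
  · refine le_trans (le_of_eq ?_) (single_le_sum (fun _ _ => Nat.zero_le _) (mem_univ v))
    cases t with
    | zero => exact hc.zero v
    | succ t =>
      rw [hc.succ, sum_eq_zero, add_zero]
      intro w _
      refine if_neg ?_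
      rintro ⟨-, -, a, d, h2, -⟩
      simp [h1] at h2
  · calc count t v ≤ ∑ w with label t w = wave a d, count t w :=
          single_le_sum (f := count t) (fun _ _ => Nat.zero_le _) (by simp [h1])
      _ ≤ ∑ w with d ≤ depth G own a w, f w := hc.sum_count_le h hG a t d
      _ ≤ ∑ w, f w := sum_le_sum_of_subset (filter_subset _ _)

/-- The sums of a level are complete when the root is the only one of its wave and is done. -/
lemma sum_count_eq (hc : IsCount G label parent f count) (h : IsWave G own label parent done)
    (hG : G.Connected) {a t : ℕ} {r : V} (hl : label t r = wave a 0) (hd : done t r)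
    (huniq : ∀ w, own w = wave a 0 → w = r) (m : ℕ) :
    ∀ j, (∀ v, G.dist r v < j + m) →
      ∑ v with G.dist r v = j, count (t - j) v = ∑ v with j ≤ G.dist r v, f v := by
  classical
  have hcov := h.covered_of_done hG hl hd huniq
  induction m with
  | zero =>
    intro j hj
    rw [filter_false_of_mem, filter_false_of_mem]
    · simp
    · intro v _; have := hj v; omega
    · intro v _; have := hj v; omega
  | succ m ih =>
    intro j hj
    have ih' := ih (j + 1) fun v => by have := hj v; omega
    have h3 : ∑ v with j ≤ G.dist r v, f v =
        ∑ v with G.dist r v = j, f v + ∑ v with j + 1 ≤ G.dist r v, f v := by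
      rw [← sum_union]
      · congr 1
        ext v
        simp only [mem_filter, mem_univ, true_and, mem_union]
        omega
      · rw [disjoint_filter]
        intro v _ h4
        omega
    rw [h3, ← ih']
    have h4 : ∀ v, G.dist r v = j → count (t - j) v = f v +
        ∑ w with G.dist r w = j + 1, if parent (t - (j + 1)) w = some v then
          count (t - (j + 1)) w else 0 := by
      intro v hv
      obtain ⟨h5, h6, h7⟩ := hcov j v hv
      obtain ⟨s, hs⟩ : ∃ s, t - j = s + 1 := ⟨t - j - 1, by omega⟩
      have hs' : t - (j + 1) = s := by omega
      rw [hs, hs', hc.succ, sum_filter]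
      rw [hs] at h6 h7
      congr 1
      refine sum_congr rfl fun w _ => ?_
      by_cases hw : G.dist r w = j + 1
      · obtain ⟨h8, h9, -⟩ := hcov _ w hw
        rw [hs'] at h9
        rw [if_pos hw]
        refine if_congr ⟨fun h => h.2.1, fun hp => ⟨?_, hp, a, j, h6, h9⟩⟩ rfl rfl
        obtain ⟨s', rfl⟩ : ∃ s', s = s' + 1 := ⟨s - 1, by omega⟩
        exact (h.parent_spec s' w v hp).1.symm
      · rw [if_neg hw, if_neg]
        rintro ⟨-, -, a', d', h8, h9⟩
        rw [h6, wave_inj] at h8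
        obtain ⟨rfl, rfl⟩ := h8
        have := h.label_eq_depth hG h9
        rw [depth_eq_dist (h.own_of_label_zero hl) huniq] at this
        exact hw this.symm
    rw [sum_congr rfl fun v hv => h4 v (mem_filter.1 hv).2, sum_add_distrib, sum_comm]
    congr 1
    refine sum_congr rfl fun w hw => ?_
    obtain ⟨h8, h9, -⟩ := hcov _ w (mem_filter.1 hw).2
    obtain ⟨s, hs⟩ : ∃ s, t - (j + 1) = s + 1 := ⟨t - (j + 1) - 1, by omega⟩
    rw [hs] at h9 ⊢
    obtain ⟨u, hu⟩ : ∃ u, parent (s + 1) w = some u := by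
      refine h.parent_exists s w ?_
      rcases h.label_cases s w with h10 | h10
      · rw [h9] at h10
        rcases h.own_eq w with h11 | ⟨b, h11⟩ <;> simp [h11] at h10
      · exact h10
    obtain ⟨h10, h11⟩ := h.parent_spec s w u hu
    obtain ⟨e, he, h12⟩ := succ_eq_wave (h11.symm.trans h9)
    have h13 := h.label_eq_depth hG h12
    rw [depth_eq_dist (h.own_of_label_zero hl) huniq] at h13
    rw [sum_eq_single u]
    · rw [if_pos hu]
    · intro v _ hv
      rw [if_neg]
      rw [hu]
      intro h14
      exact hv (Option.some_injective _ h14).symm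
    · intro h14
      exact absurd (mem_filter.2 ⟨mem_univ _, by omega⟩) h14

lemma count_root_eq (hc : IsCount G label parent f count) (h : IsWave G own label parent done)
    (hG : G.Connected) {a t : ℕ} {r : V} (hl : label t r = wave a 0) (hd : done t r)
    (huniq : ∀ w, own w = wave a 0 → w = r) : count t r = ∑ v, f v := by
  classical
  have h1 := hc.sum_count_eq h hG hl hd huniq t 0 fun v => by
    have := (h.covered_of_done hG hl hd huniq _ v rfl).1
    omega
  have h2 : ({v | G.dist r v = 0} : Finset V) = {r} := by
    ext v
    simp only [mem_filter, mem_univ, true_and, mem_singleton, hG.dist_eq_zero_iff]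
    exact eq_comm
  rw [h2] at h1
  simpa using h1

end IsCount

/-! ### Pipelined flooding -/

/-- Flooding in batches of `B`. Whatever a node has sent is known to its neighbours (and to
itself); in each round it sends `B` new items, or all those that it knows. -/
structure IsFlood {V : Type} (G : SimpleGraph V) (B : ℕ) (own : V → Finset ℕ)
    (known sent : ℕ → V → Finset ℕ) : Prop where
  known_zero : ∀ v, own v ⊆ known 0 v
  known_mono : ∀ t v, known t v ⊆ known (t + 1) v
  sent_mono : ∀ t v, sent t v ⊆ sent (t + 1) v
  sent_subset : ∀ t v w, w = v ∨ G.Adj v w → sent t w ⊆ known t v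
  batch_full : ∀ t v, B + (sent t v).card ≤ (sent (t + 1) v).card ∨ known t v ⊆ sent (t + 1) v

namespace IsFlood

variable {V : Type} {G : SimpleGraph V} {B : ℕ} {own : V → Finset ℕ}
  {known sent : ℕ → V → Finset ℕ}

lemma sent_of_known (h : IsFlood G B own known sent) {d : ℕ} {v : V}
    (hk : ∀ i, B * (i + 1) ≤ (known (d + i) v).card ∨
      ∀ u, G.dist u v ≤ d → own u ⊆ known (d + i) v) (i : ℕ) :
    B * i ≤ (sent (d + i) v).card ∨ ∀ u, G.dist u v ≤ d → own u ⊆ sent (d + i) v := by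
  induction i with
  | zero => simp
  | succ i ih =>
    rw [← add_assoc]
    rcases ih with h1 | h1
    · rcases h.batch_full (d + i) v with h2 | h2
      · left
        rw [mul_add]
        omega
      · rcases hk i with h3 | h3
        · exact Or.inl (h3.trans (card_le_card h2))
        · exact Or.inr fun u hu => (h3 u hu).trans h2
    · exact Or.inr fun u hu => (h1 u hu).trans (h.sent_mono _ _)

/-- Within `d + i` rounds, a node gets to know everything from within distance `d`, or at least
`B * (i + 1)` items. The order in which items are forwarded does not matter: a neighbour that ever
sent less than a full batch had sent all it knew, and has been busy since. -/
lemma known_within (h : IsFlood G B own known sent) (hG : G.Connected) (d : ℕ) :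
    ∀ v i, B * (i + 1) ≤ (known (d + i) v).card ∨
      ∀ u, G.dist u v ≤ d → own u ⊆ known (d + i) v := by
  induction d with
  | zero =>
    intro v i
    right
    intro u hu
    obtain rfl := hG.dist_eq_zero_iff.1 (Nat.le_zero.1 hu)
    induction i with
    | zero => exact h.known_zero u
    | succ i ih => exact ih.trans (h.known_mono _ _)
  | succ d ih =>
    intro v i
    by_cases hex : ∃ w, (w = v ∨ G.Adj v w) ∧ B * (i + 1) ≤ (sent (d + (i + 1)) w).card
    · obtain ⟨w, hw, h1⟩ := hex
      left
      rw [show d + 1 + i = d + (i + 1) by ring]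
      exact h1.trans (card_le_card (h.sent_subset _ _ _ hw))
    · right
      intro u hu
      obtain ⟨w, hw, hwd⟩ : ∃ w, (w = v ∨ G.Adj v w) ∧ G.dist u w ≤ d := by
        obtain ⟨p, hp⟩ := hG.exists_walk_length_eq_dist v u
        rw [SimpleGraph.dist_comm] at hu
        cases p with
        | nil => exact ⟨v, Or.inl rfl, by simp⟩
        | @cons _ w _ hadj q =>
          rw [SimpleGraph.Walk.length_cons] at hp
          have h1 := SimpleGraph.dist_le q.reverse
          rw [SimpleGraph.Walk.length_reverse] at h1
          exact ⟨w, Or.inr hadj, by omega⟩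
      rw [show d + 1 + i = d + (i + 1) by ring]
      refine (((h.sent_of_known (ih w) (i + 1)).resolve_left fun h1 => hex ⟨w, hw, h1⟩) u
        hwd).trans (h.sent_subset _ _ _ hw)

end IsFlood

/-! ### The algorithm -/

/-- The data that start the final phase: the number of tokens that fit into a message, the number
of tokens in the network (nodes with a repeated token count one extra) and the time at which the
root had completed its count. -/
structure Plan where
  batchSize : ℕ
  total : ℕ
  start : ℕ

/-- The contents of a message of a node at work. The counts are zero unless the receiver is the
parent of the sender. -/
structure Report where
  label : Label
  done : Prop
  nodeCount : ℕ
  tokenCount : ℕ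
  plan : Option Plan
  batch : List ℕ

/-- The memory of a node at work: what it was given (`knowledge`, `tokens`, `weight`), the number
of past rounds, its position in the waves, the sums collected from its subtree, the plan as soon as
it has heard of it, and the tokens it has received and sent in the final phase. -/
structure Memory (d : ℕ) where
  knowledge : Knowledge
  tokens : Finset ℕ
  weight : ℕ
  clock : ℕ
  label : Label
  parent : Option (Fin d)
  done : Prop
  nodeCount : ℕ
  tokenCount : ℕ
  plan : Option Plan
  known : Finset ℕ
  sent : Finset ℕ

/-- The codes of a collection of tokens. -/
def codes (x : Multiset Token) : Finset ℕ := (x.map tokenCode).toFinset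

open Classical in
/-- The number of distinct tokens, plus one if a token is repeated. Unlike the number of tokens
this is bounded in terms of the token length. -/
noncomputable def weight (x : Multiset Token) : ℕ := (codes x).card + if x.Nodup then 0 else 1

/-- The label with which a node starts the wave of its smallest token. -/
def ownLabel (S : Finset ℕ) : Label := S.inf fun a => wave a 0

namespace Memory

variable {d : ℕ}

/-- The memory at the start. -/
noncomputable def init (κ : Knowledge) (d : ℕ) (x : Multiset Token) : Memory d where
  knowledge := κ
  tokens := codes x
  weight := TokenCollision.weight x
  clock := 0
  label := ownLabel (codes x)
  parent := none
  done := False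
  nodeCount := 1
  tokenCount := TokenCollision.weight x
  plan := none
  known := codes x
  sent := ∅

/-- The tokens that the node sends in this round to all its neighbours. -/
def batch (p : Memory d) : List ℕ :=
  match p.plan with
  | none => []
  | some q => if 2 * q.start ≤ p.clock then
      ((p.known \ p.sent).sort (· ≤ ·)).take q.batchSize else []

open Classical in
/-- The message through the edge with label `j`. -/
noncomputable def report (p : Memory d) (j : Fin d) : Report where
  label := p.label
  done := p.done
  nodeCount := if p.parent = some j then p.nodeCount else 0
  tokenCount := if p.parent = some j then p.tokenCount else 0
  plan := p.plan
  batch := p.batch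

/-- The node is the root of a wave that is done. -/
def RootDone (p : Memory d) : Prop := p.done ∧ ∃ a, p.label = wave a 0

/-- The sums agree with the given global number, and there are not more tokens than the code of the
token of the wave (which is at least the number of strings of that length). -/
def Accepts (p : Memory d) : Prop :=
  p.tokenCount ≤ p.label.token ∧
    match p.knowledge with
    | .nodes n => p.nodeCount = n
    | .tokens k => p.tokenCount = k

/-- The plan of a root that accepts. A batch holds about `log n / L` tokens. -/
def newPlan (p : Memory d) : Plan :=
  ⟨max 1 (p.nodeCount.size / p.label.token.size), p.tokenCount, p.clock⟩

/-- The label offered by a node itself and its neighbours. -/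
noncomputable def nextLabel (p : Memory d) (m : Fin d → Report) : Label :=
  ownLabel p.tokens ⊓ univ.inf fun i => (m i).label.succ

open Classical in
/-- The memory after a round, but for the plan. -/
noncomputable def update (p : Memory d) (m : Fin d → Report) : Memory d :=
  { p with
    clock := p.clock + 1
    label := p.nextLabel m
    parent := if h : ∃ i, p.nextLabel m = (m i).label.succ then some h.choose else none
    done := ∃ a e, p.nextLabel m = wave a e ∧
      ∀ i, (∃ e', (m i).label = wave a e') ∧ ((m i).label = wave a (e + 1) → (m i).done)
    nodeCount := 1 + ∑ i, if ∃ a e, p.nextLabel m = wave a e ∧ (m i).label = wave a (e + 1) then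
      (m i).nodeCount else 0
    tokenCount := p.weight + ∑ i, if ∃ a e, p.nextLabel m = wave a e ∧
      (m i).label = wave a (e + 1) then (m i).tokenCount else 0
    known := p.known ∪ univ.biUnion fun i => (m i).batch.toFinset
    sent := p.sent ∪ p.batch.toFinset }

open Classical in
/-- The memory after a round in which the reports `m` were received. -/
noncomputable def step (p : Memory d) (m : Fin d → Report) : Memory d :=
  { p.update m with
    plan := if p.plan ≠ none then p.plan
      else if (p.update m).RootDone ∧ (p.update m).Accepts then some (p.update m).newPlan
      else if h : ∃ i, (m i).plan ≠ none then (m h.choose).plan else none }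

/-- The result of a node, at the end of the final phase. -/
def verdict (p : Memory d) : Option Bool :=
  match p.plan with
  | none => none
  | some q => if 4 * q.start + q.total / q.batchSize ≤ p.clock then
      some (decide (p.known.card = q.total)) else none

end Memory

/-- A message stands for an alarm (a collision was found) or for a report. -/
inductive Signal : Type
  | alarm : Signal
  | report (m : Report) : Signal

/-- The contents of a report, and nothing in case of an alarm. -/
def Signal.toReport : Signal → Report
  | alarm => ⟨⊤, False, 0, 0, none, []⟩
  | report m => m

open Classical in
/-- The truth value of a proposition as a number. -/
noncomputable def truthValue (P : Prop) : ℕ := if P then 1 else 0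

lemma truthValue_le (P : Prop) : truthValue P ≤ 1 := by
  unfold truthValue
  split_ifs <;> simp

lemma truthValue_injective : Function.Injective truthValue := by
  intro P Q h
  unfold truthValue at h
  split_ifs at h <;> simp_all

/-- The numbers that make up a plan. -/
def planList : Option Plan → List ℕ
  | none => [0, 0, 0, 0]
  | some q => [1, q.batchSize, q.total, q.start]

/-- The numbers that make up a signal. -/
noncomputable def Signal.toList : Signal → List ℕ
  | alarm => [0]
  | report m =>
    [1, truthValue (m.label = ⊤), m.label.token, m.label.distance, truthValue m.done,
      m.nodeCount, m.tokenCount] ++ planList m.plan ++ m.batch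

/-- The bit string that stands for a signal. -/
noncomputable def Signal.encode (s : Signal) : Message := encodeList s.toList

lemma Signal.toList_injective : Function.Injective Signal.toList := by
  intro s s' h
  cases s with
  | alarm => cases s' <;> simp_all [Signal.toList]
  | report m =>
    cases s' with
    | alarm => simp [Signal.toList] at h
    | report m' =>
      obtain ⟨l, dn, nc, tc, pl, b⟩ := m
      obtain ⟨l', dn', nc', tc', pl', b'⟩ := m'
      simp only [Signal.toList, List.cons_append, List.nil_append, List.cons.injEq] at h
      obtain ⟨-, h1, h2, h3, h4, h5, h6, h7⟩ := h
      have h1' : (l = ⊤) = (l' = ⊤) := truthValue_injective h1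
      have hl : l = l' := by
        rcases label_cases l with rfl | ⟨a, d, rfl⟩ <;>
          rcases label_cases l' with rfl | ⟨a', d', rfl⟩ <;> simp_all
      have hd : dn = dn' := truthValue_injective h4
      have hp : pl = pl' ∧ b = b' := by
        rcases pl with _ | ⟨q1, q2, q3⟩ <;> rcases pl' with _ | ⟨q1', q2', q3'⟩ <;>
          simp_all [planList]
      simp [hl, hd, h5, h6, hp.1, hp.2]

/-- The signal that a bit string stands for. -/
noncomputable def decode : Message → Signal :=
  haveI : Nonempty Signal := ⟨.alarm⟩
  Function.invFun Signal.encode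

@[simp] lemma decode_encode (s : Signal) : decode s.encode = s :=
  haveI : Nonempty Signal := ⟨.alarm⟩
  Function.leftInverse_invFun (encodeList_injective.comp Signal.toList_injective) s

/-- The state of a node: at work, about to pass on an alarm, or halted because of an alarm. -/
inductive NodeState (d : ℕ) : Type
  | run (p : Memory d) : NodeState d
  | alarm : NodeState d
  | halt : NodeState d

open Classical in
/-- The algorithm. The wave of the smallest token gives a tree in which the root counts nodes and
tokens. A root whose counts do not agree with the global knowledge raises an alarm, which spreads
to all nodes and ends the execution. Otherwise the root announces a plan, by which all nodes at the
same time start to flood the tokens, and stop. -/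
noncomputable def algorithm : Algorithm where
  State := NodeState
  init κ d x := .run (Memory.init κ d x)
  send s i :=
    match s with
    | .run p => (Signal.report (p.report i)).encode
    | .alarm => Signal.alarm.encode
    | .halt => []
  receive s m :=
    match s with
    | .run p =>
      if ∃ i, decode (m i) = .alarm then .alarm
      else if (p.step fun i => (decode (m i)).toReport).RootDone ∧
          ¬ (p.step fun i => (decode (m i)).toReport).Accepts then .alarm
      else .run (p.step fun i => (decode (m i)).toReport)
    | .alarm => .halt
    | .halt => .halt
  output s :=
    match s with
    | .run p => p.verdict
    | .alarm => none
    | .halt => some false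

/-! ### The execution without alarms -/

variable {V : Type}

/-- The memories after `t` rounds if alarms are ignored and nobody halts. -/
noncomputable def ideal (N : Network V) (κ : Knowledge) (x : V → Multiset Token) :
    ℕ → (v : V) → Memory (N.deg v)
  | 0 => fun v => Memory.init κ (N.deg v) (x v)
  | t + 1 => fun v => (ideal N κ x t v).step
      fun i => (ideal N κ x t (N.port v i : V)).report (N.backPort v i)

section Ideal

variable (N : Network V) (κ : Knowledge) (x : V → Multiset Token)

lemma ideal_given (t : ℕ) (v : V) : (ideal N κ x t v).knowledge = κ ∧
    (ideal N κ x t v).tokens = codes (x v) ∧ (ideal N κ x t v).weight = weight (x v) ∧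
    (ideal N κ x t v).clock = t := by
  induction t with
  | zero => exact ⟨rfl, rfl, rfl, rfl⟩
  | succ t ih => exact ⟨ih.1, ih.2.1, ih.2.2.1, congrArg (· + 1) ih.2.2.2⟩

lemma port_backPort (v : V) (i : Fin (N.deg v)) :
    (N.port (N.port v i : V) (N.backPort v i) : V) = v := by
  simp [Network.backPort]

lemma port_adj (v : V) (i : Fin (N.deg v)) : N.graph.Adj v (N.port v i : V) := (N.port v i).2

lemma exists_port {v w : V} (h : N.graph.Adj v w) : ∃ i, (N.port v i : V) = w :=
  ⟨(N.port v).symm ⟨w, h⟩, by simp⟩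

/-- The parent of a node, as a node. -/
noncomputable def idealParent (t : ℕ) (v : V) : Option V :=
  (ideal N κ x t v).parent.map fun j => (N.port v j : V)

lemma ideal_parent_iff (t : ℕ) (v : V) (i : Fin (N.deg v)) :
    (ideal N κ x t (N.port v i : V)).parent = some (N.backPort v i) ↔
      idealParent N κ x t (N.port v i : V) = some v := by
  unfold idealParent
  rw [Option.map_eq_some_iff]
  constructor
  · intro h
    exact ⟨_, h, port_backPort N v i⟩
  · rintro ⟨j, h1, h2⟩
    rw [h1]
    congr 1
    apply (N.port (N.port v i : V)).injective
    apply Subtype.ext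
    rw [h2, port_backPort]

lemma ownLabel_cases (S : Finset ℕ) : ownLabel S = ⊤ ∨ ∃ a ∈ S, ownLabel S = wave a 0 := by
  rcases S.eq_empty_or_nonempty with rfl | hS
  · exact Or.inl rfl
  · obtain ⟨a, ha, h⟩ := exists_mem_eq_inf S hS fun a => wave a 0
    exact Or.inr ⟨a, ha, h⟩

lemma ideal_label_succ (t : ℕ) (v : V) : (ideal N κ x (t + 1) v).label =
    ownLabel (codes (x v)) ⊓ univ.inf fun i => (ideal N κ x t (N.port v i : V)).label.succ := by
  rw [← (ideal_given N κ x t v).2.1]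
  rfl

lemma ideal_isWave : IsWave N.graph (fun v => ownLabel (codes (x v)))
    (fun t v => (ideal N κ x t v).label) (idealParent N κ x)
    (fun t v => (ideal N κ x t v).done) where
  own_eq v := by
    rcases ownLabel_cases (codes (x v)) with h | ⟨a, -, h⟩
    · exact Or.inl h
    · exact Or.inr ⟨a, h⟩
  label_zero v := rfl
  label_le_own t v := by
    cases t with
    | zero => exact le_rfl
    | succ t => rw [ideal_label_succ]; exact inf_le_left
  label_le t v w h := by
    obtain ⟨i, rfl⟩ := exists_port N h
    rw [ideal_label_succ]
    exact inf_le_right.trans (inf_le (mem_univ i))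
  label_cases t v := by
    rw [ideal_label_succ]
    rcases (univ : Finset (Fin (N.deg v))).eq_empty_or_nonempty with h | h
    · left
      rw [h]
      simp
    · obtain ⟨i, -, hi⟩ := exists_mem_eq_inf univ h
        fun i => (ideal N κ x t (N.port v i : V)).label.succ
      rw [hi]
      rcases le_total (ownLabel (codes (x v)))
        (ideal N κ x t (N.port v i : V)).label.succ with h1 | h1
      · exact Or.inl (inf_eq_left.2 h1)
      · exact Or.inr ⟨_, port_adj N v i, inf_eq_right.2 h1⟩
  parent_spec t v w h := by
    obtain ⟨j, hj, rfl⟩ := Option.map_eq_some_iff.1 h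
    refine ⟨port_adj N v j, ?_⟩
    simp only [ideal, Memory.step, Memory.update] at hj ⊢
    split_ifs at hj with hex
    rw [← Option.some_injective _ hj]
    exact hex.choose_spec
  parent_exists t v h := by
    obtain ⟨w, hw, h⟩ := h
    obtain ⟨i, rfl⟩ := exists_port N hw
    simp only [idealParent, ideal, Memory.step, Memory.update]
    rw [dif_pos ⟨i, h⟩]
    simp
  done_zero v h := h
  done_succ t v := by
    constructor
    · rintro ⟨a, d, h1, h2⟩
      refine ⟨a, d, h1, fun w hw => ?_⟩
      obtain ⟨i, rfl⟩ := exists_port N hw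
      exact h2 i
    · rintro ⟨a, d, h1, h2⟩
      exact ⟨a, d, h1, fun i => h2 _ (port_adj N v i)⟩

variable [Fintype V]

open Classical in
lemma sum_port (v : V) (F : V → ℕ) :
    ∑ i, F (N.port v i : V) = ∑ w, if N.graph.Adj v w then F w else 0 := by
  rw [Equiv.sum_comp (N.port v) fun w => F (w : V), ← sum_filter]
  rw [Finset.sum_set_coe (N.graph.neighborSet v)]
  refine sum_congr ?_ fun _ _ => rfl
  ext w
  simp

open Classical in
/-- The counts of the memories, whose summands are cut off at the sender, are the sums over
children. -/
lemma sum_children (t : ℕ) (v : V) (count : V → ℕ) :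
    (∑ i, if ∃ a e, (ideal N κ x (t + 1) v).label = wave a e ∧
        (ideal N κ x t (N.port v i : V)).label = wave a (e + 1) then
      (if (ideal N κ x t (N.port v i : V)).parent = some (N.backPort v i) then
        count (N.port v i : V) else 0) else 0) =
    ∑ w, if N.graph.Adj v w ∧ idealParent N κ x t w = some v ∧
      ∃ a e, (ideal N κ x (t + 1) v).label = wave a e ∧
        (ideal N κ x t w).label = wave a (e + 1) then count w else 0 := by
  simp only [ideal_parent_iff]
  rw [sum_port N v fun w => if ∃ a e, (ideal N κ x (t + 1) v).label = wave a e ∧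
    (ideal N κ x t w).label = wave a (e + 1) then
      (if idealParent N κ x t w = some v then count w else 0) else 0]
  refine sum_congr rfl fun w _ => ?_
  simp only [← ite_and]
  refine if_congr ?_ rfl rfl
  tauto

lemma ideal_nodeCount : IsCount N.graph (fun t v => (ideal N κ x t v).label)
    (idealParent N κ x) (fun _ => 1) (fun t v => (ideal N κ x t v).nodeCount) where
  zero v := rfl
  succ t v := by
    classical
    exact congrArg (1 + ·) (sum_children N κ x t v fun w => (ideal N κ x t w).nodeCount)

lemma ideal_tokenCount : IsCount N.graph (fun t v => (ideal N κ x t v).label)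
    (idealParent N κ x) (fun v => weight (x v)) (fun t v => (ideal N κ x t v).tokenCount) where
  zero v := rfl
  succ t v := by
    classical
    rw [← sum_children N κ x t v fun w => (ideal N κ x t w).tokenCount,
      ← (ideal_given N κ x t v).2.2.1]
    rfl

end Ideal

/-! ### Weights and collisions -/

lemma codes_card_eq_iff (x : Multiset Token) : (codes x).card = Multiset.card x ↔ x.Nodup := by
  rw [codes, ← Multiset.card_map tokenCode x, Multiset.toFinset_card_eq_card_iff_nodup,
    Multiset.nodup_map_iff_of_injective tokenCode_injective]

lemma codes_card_le (x : Multiset Token) : (codes x).card ≤ Multiset.card x := by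
  rw [codes, ← Multiset.card_map tokenCode x]
  exact Multiset.toFinset_card_le _

lemma weight_of_nodup {x : Multiset Token} (h : x.Nodup) : weight x = Multiset.card x := by
  rw [weight, if_pos h, add_zero, codes_card_eq_iff]
  exact h

lemma codes_card_le_weight (x : Multiset Token) : (codes x).card ≤ weight x :=
  Nat.le_add_right _ _

lemma nodup_of_weight_le {x : Multiset Token} (h : weight x ≤ (codes x).card) : x.Nodup := by
  by_contra h'
  rw [weight, if_neg h'] at h
  omega

lemma weight_le_card (x : Multiset Token) : weight x ≤ Multiset.card x := by
  by_cases h : x.Nodup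
  · exact (weight_of_nodup h).le
  · rw [weight, if_neg h]
    exact (codes_card_le x).lt_of_ne fun h' => h ((codes_card_eq_iff x).1 h')

lemma mem_codes_of_ownLabel {S : Finset ℕ} {a : ℕ} (h : ownLabel S = wave a 0) : a ∈ S := by
  rcases ownLabel_cases S with h' | ⟨b, hb, h'⟩
  · simp [h'] at h
  · rw [h', wave_inj] at h
    rwa [← h.1]

section Total

variable {V : Type} [Fintype V] (x : V → Multiset Token)

/-- The codes of all tokens in the network. -/
def allCodes : Finset ℕ := univ.biUnion fun v => codes (x v)

/-- The number of tokens, where a node with a repeated token counts one extra instead of all its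
repetitions. -/
noncomputable def totalWeight : ℕ := ∑ v, weight (x v)

lemma allCodes_eq : allCodes x = codes (∑ v, x v) := by
  ext a
  simp only [allCodes, codes, mem_biUnion, mem_univ, true_and, Multiset.mem_toFinset,
    Multiset.mem_map, Multiset.mem_sum]
  constructor
  · rintro ⟨v, τ, h, rfl⟩
    exact ⟨τ, ⟨v, h⟩, rfl⟩
  · rintro ⟨τ, ⟨v, h⟩, rfl⟩
    exact ⟨v, τ, h, rfl⟩

lemma card_allCodes_le : (allCodes x).card ≤ totalWeight x :=
  card_biUnion_le.trans (sum_le_sum fun _ _ => codes_card_le_weight _)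

lemma totalWeight_le : totalWeight x ≤ numTokens x := sum_le_sum fun _ _ => weight_le_card _

lemma card_sum_eq : Multiset.card (∑ v, x v) = numTokens x := Multiset.card_sum _ _

variable {x}

lemma nodup_of_not_hasCollision (h : ¬ HasCollision x) (v : V) : (x v).Nodup :=
  Multiset.nodup_of_le (single_le_sum (fun _ _ => Multiset.zero_le _) (mem_univ v))
    (not_not.1 h)

lemma eq_of_mem_of_not_hasCollision (h : ¬ HasCollision x) {u v : V} {τ : Token} (hu : τ ∈ x u)
    (hv : τ ∈ x v) : u = v := by
  classical
  by_contra huv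
  have h1 := Multiset.nodup_iff_count_le_one.1 (not_not.1 h) τ
  rw [Multiset.count_sum'] at h1
  have h2 : ∑ w ∈ {u, v}, (x w).count τ ≤ ∑ w, (x w).count τ :=
    sum_le_sum_of_subset (subset_univ _)
  rw [sum_pair huv] at h2
  have := Multiset.count_pos.2 hu
  have := Multiset.count_pos.2 hv
  omega

lemma totalWeight_of_not_hasCollision (h : ¬ HasCollision x) : totalWeight x = numTokens x :=
  sum_congr rfl fun v _ => weight_of_nodup (nodup_of_not_hasCollision h v)

lemma card_allCodes_eq_iff : (allCodes x).card = totalWeight x ↔ ¬ HasCollision x := by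
  constructor
  · intro h
    have h1 : ∀ v, weight (x v) ≤ (codes (x v)).card := by
      have h2 : ∑ v, (codes (x v)).card = ∑ v, weight (x v) :=
        le_antisymm (sum_le_sum fun _ _ => codes_card_le_weight _) (h.symm.le.trans card_biUnion_le)
      intro v
      exact ((sum_eq_sum_iff_of_le fun _ _ => codes_card_le_weight _).1 h2 v (mem_univ v)).ge
    have h2 : totalWeight x = numTokens x :=
      sum_congr rfl fun v _ => weight_of_nodup (nodup_of_weight_le (h1 v))
    rw [allCodes_eq, h2, ← card_sum_eq, codes_card_eq_iff] at h
    exact not_not.2 h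
  · intro h
    rw [totalWeight_of_not_hasCollision h, allCodes_eq, ← card_sum_eq, codes_card_eq_iff]
    exact not_not.1 h

variable {L : ℕ}

lemma mem_codes_bounds {y : Multiset Token} (hL : ∀ τ ∈ y, τ.length = L) {a : ℕ}
    (ha : a ∈ codes y) : 2 ^ L ≤ a ∧ a < 2 ^ (L + 1) := by
  rw [codes, Multiset.mem_toFinset, Multiset.mem_map] at ha
  obtain ⟨τ, hτ, rfl⟩ := ha
  rw [← hL τ hτ]
  exact tokenCode_bounds τ

lemma card_codes_le_pow {y : Multiset Token} (hL : ∀ τ ∈ y, τ.length = L) :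
    (codes y).card ≤ 2 ^ L := by
  have h : codes y ⊆ Ico (2 ^ L) (2 ^ (L + 1)) := fun a ha =>
    mem_Ico.2 (mem_codes_bounds hL ha)
  have := card_le_card h
  rw [Nat.card_Ico, pow_succ] at this
  omega

lemma numTokens_le_pow (hL : ∀ v, ∀ τ ∈ x v, τ.length = L) (h : ¬ HasCollision x) :
    numTokens x ≤ 2 ^ L := by
  rw [← totalWeight_of_not_hasCollision h, ← card_allCodes_eq_iff.2 h, allCodes_eq]
  refine card_codes_le_pow fun τ hτ => ?_
  obtain ⟨v, -, hv⟩ := Multiset.mem_sum.1 hτ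
  exact hL v τ hv

end Total

/-! ### The decision of the root -/

section Root

variable {V : Type} [Fintype V] {N : Network V} {κ : Knowledge} {x : V → Multiset Token} {L : ℕ}

lemma accepts_iff {d : ℕ} {p q : Memory d} (h1 : p.knowledge = q.knowledge)
    (h2 : p.label = q.label) (h3 : p.nodeCount = q.nodeCount)
    (h4 : p.tokenCount = q.tokenCount) : p.Accepts ↔ q.Accepts := by
  rw [Memory.Accepts, Memory.Accepts, h1, h2, h3, h4]

/-- A done root that is the only one of its wave has the exact counts. -/
lemma counts_of_unique {a t : ℕ} {r : V} (hl : (ideal N κ x t r).label = wave a 0)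
    (hd : (ideal N κ x t r).done) (huniq : ∀ w, ownLabel (codes (x w)) = wave a 0 → w = r) :
    (ideal N κ x t r).nodeCount = Fintype.card V ∧
      (ideal N κ x t r).tokenCount = totalWeight x := by
  have hw := ideal_isWave N κ x
  refine ⟨?_, (ideal_tokenCount N κ x).count_root_eq hw N.connected hl hd huniq⟩
  rw [(ideal_nodeCount N κ x).count_root_eq hw N.connected hl hd huniq]
  simp

/-- A root rejects only if there is a collision. -/
lemma hasCollision_of_not_accepts
    (hκ : κ = .nodes (Fintype.card V) ∨ κ = .tokens (numTokens x))
    (hL : ∀ v, ∀ τ ∈ x v, τ.length = L) {t : ℕ} {r : V} (hd : (ideal N κ x t r).RootDone)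
    (ha : ¬ (ideal N κ x t r).Accepts) : HasCollision x := by
  by_contra hno
  obtain ⟨hd, a, hl⟩ := hd
  have hr := (ideal_isWave N κ x).own_of_label_zero hl
  have huniq : ∀ w, ownLabel (codes (x w)) = wave a 0 → w = r := by
    intro w hw
    have h1 := mem_codes_of_ownLabel hw
    have h2 := mem_codes_of_ownLabel hr
    rw [codes, Multiset.mem_toFinset, Multiset.mem_map] at h1 h2
    obtain ⟨τ, hτ, rfl⟩ := h1
    obtain ⟨τ', hτ', h⟩ := h2
    rw [tokenCode_injective h] at hτ'
    exact eq_of_mem_of_not_hasCollision hno hτ hτ'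
  obtain ⟨h1, h2⟩ := counts_of_unique hl hd huniq
  -- Without a collision there are at most `2 ^ L` tokens, and the codes start at `2 ^ L`.
  refine ha ⟨?_, ?_⟩
  · rw [h2, hl, token_wave, totalWeight_of_not_hasCollision hno]
    exact (numTokens_le_pow hL hno).trans
      (mem_codes_bounds (hL r) (mem_codes_of_ownLabel hr)).1
  · rw [(ideal_given N κ x t r).1, h1, h2, totalWeight_of_not_hasCollision hno]
    rcases hκ with rfl | rfl <;> rfl

/-- What a root that accepts knows: it is the only root of the wave of the smallest token, and its
counts are exact. -/
structure Leads (N : Network V) (x : V → Multiset Token) (t : ℕ) (r : V) (a : ℕ) : Prop where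
  own : ownLabel (codes (x r)) = wave a 0
  unique : ∀ w, ownLabel (codes (x w)) = wave a 0 → w = r
  le_own : ∀ w, wave a 0 ≤ ownLabel (codes (x w))
  dist_lt : ∀ v, N.graph.dist r v < t
  total_le : totalWeight x ≤ a

/-- If a second node started the wave of the root, then the count of the root would miss it. -/
lemma leads_of_accepts (hκ : κ = .nodes (Fintype.card V) ∨ κ = .tokens (numTokens x))
    {t : ℕ} {r : V} (hd : (ideal N κ x t r).RootDone) (ha : (ideal N κ x t r).Accepts) :
    ∃ a, Leads N x t r a ∧ (ideal N κ x t r).label = wave a 0 ∧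
      (ideal N κ x t r).nodeCount = Fintype.card V ∧
      (ideal N κ x t r).tokenCount = totalWeight x := by
  obtain ⟨hd, a, hl⟩ := hd
  have hw := ideal_isWave N κ x
  have hr := hw.own_of_label_zero hl
  obtain ⟨ha1, ha2⟩ := ha
  have huniq : ∀ w, ownLabel (codes (x w)) = wave a 0 → w = r := by
    intro u hu
    by_contra hur
    rw [(ideal_given N κ x t r).1] at ha2
    rcases hκ with rfl | rfl
    · have h := (ideal_nodeCount N _ x).count_root_add_le hw N.connected hl hu hur
      simp only [sum_const, card_univ, smul_eq_mul, mul_one] at h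
      change (ideal N _ x t r).nodeCount = _ at ha2
      omega
    · have h := (ideal_tokenCount N _ x).count_root_add_le hw N.connected hl hu hur
      change (ideal N _ x t r).tokenCount = _ at ha2
      have h1 : 0 < (codes (x u)).card := card_pos.2 ⟨a, mem_codes_of_ownLabel hu⟩
      have h2 := codes_card_le_weight (x u)
      have h3 := totalWeight_le x
      rw [totalWeight] at h3
      omega
  obtain ⟨h1, h2⟩ := counts_of_unique hl hd huniq
  refine ⟨a, ⟨hr, huniq, hw.min_of_done N.connected hl hd huniq, fun v => ?_, ?_⟩, hl, h1, h2⟩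
  · exact (hw.covered_of_done N.connected hl hd huniq _ v rfl).1
  · rw [hl, token_wave, h2] at ha1
    exact ha1

lemma exists_ownLabel_min (hk : 1 ≤ numTokens x) :
    ∃ r m, ownLabel (codes (x r)) = wave m 0 ∧ ∀ u, wave m 0 ≤ ownLabel (codes (x u)) := by
  obtain ⟨v, -, hv⟩ : ∃ v ∈ univ, Multiset.card (x v) ≠ 0 :=
    exists_ne_zero_of_sum_ne_zero (by unfold numTokens at hk; omega)
  obtain ⟨r, -, hr⟩ := exists_min_image univ (fun u => ownLabel (codes (x u))) ⟨v, mem_univ v⟩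
  rcases ownLabel_cases (codes (x r)) with h | ⟨m, -, h⟩
  · exfalso
    have h1 := hr v (mem_univ v)
    rw [h, top_le_iff] at h1
    obtain ⟨τ, hτ⟩ := Multiset.card_pos_iff_exists_mem.1 (Nat.pos_of_ne_zero hv)
    have h2 : ownLabel (codes (x v)) ≤ wave (tokenCode τ) 0 :=
      inf_le (Multiset.mem_toFinset.2 (Multiset.mem_map_of_mem _ hτ))
    rw [h1] at h2
    simp at h2
  · exact ⟨r, m, h, fun u => h ▸ hr u (mem_univ u)⟩

omit [Fintype V] in
/-- The roots of the wave of the smallest token are done by time `2 D + 1`. -/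
lemma rootDone_of_min {D m : ℕ} {r : V} (hr : ownLabel (codes (x r)) = wave m 0)
    (hmin : ∀ u, wave m 0 ≤ ownLabel (codes (x u))) (hD : ∀ u v, N.graph.dist u v ≤ D) :
    (ideal N κ x (2 * D + 1) r).RootDone ∧ (ideal N κ x (2 * D + 1) r).label = wave m 0 := by
  have hw := ideal_isWave N κ x
  have h1 := hw.label_of_min N.connected hr hmin hD (show D ≤ 2 * D + 1 by omega) r
  rw [depth_self (own := fun v => ownLabel (codes (x v))) hr] at h1
  exact ⟨⟨hw.done_of_min N.connected hr hmin hD D r _ (by omega) (by omega), m, h1⟩, h1⟩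

end Root

/-! ### The final phase -/

section Final

variable {V : Type} {N : Network V} {κ : Knowledge} {x : V → Multiset Token}

/-- The node `v` is a root that accepts at time `t`. -/
def Announces (N : Network V) (κ : Knowledge) (x : V → Multiset Token) (t : ℕ) (v : V) : Prop :=
  (ideal N κ x t v).RootDone ∧ (ideal N κ x t v).Accepts

open Classical in
lemma ideal_plan_succ (t : ℕ) (v : V) : (ideal N κ x (t + 1) v).plan =
    if (ideal N κ x t v).plan ≠ none then (ideal N κ x t v).plan
    else if (ideal N κ x (t + 1) v).RootDone ∧ (ideal N κ x (t + 1) v).Accepts then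
      some (ideal N κ x (t + 1) v).newPlan
    else if h : ∃ i, (ideal N κ x t (N.port v i : V)).plan ≠ none then
      (ideal N κ x t (N.port v h.choose : V)).plan else none := rfl

lemma plan_succ_cases (t : ℕ) (v : V) :
    (ideal N κ x (t + 1) v).plan = none ∨
    (∃ w, (ideal N κ x (t + 1) v).plan = (ideal N κ x t w).plan) ∨
    (ideal N κ x t v).plan = none ∧ Announces N κ x (t + 1) v ∧
      (ideal N κ x (t + 1) v).plan = some (ideal N κ x (t + 1) v).newPlan := by
  rw [ideal_plan_succ]
  split_ifs with h1 h2 h3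
  · exact Or.inr (Or.inl ⟨v, rfl⟩)
  · exact Or.inr (Or.inr ⟨not_not.1 h1, h2, rfl⟩)
  · exact Or.inr (Or.inl ⟨_, rfl⟩)
  · exact Or.inl rfl

lemma not_announces_zero (v : V) : ¬ Announces N κ x 0 v := fun h =>
  (ideal_isWave N κ x).done_zero v h.1.1

lemma plan_eq_none {s : ℕ} (hs : ∀ t < s, ∀ v, ¬ Announces N κ x t v) (t : ℕ) (ht : t < s)
    (v : V) : (ideal N κ x t v).plan = none := by
  induction t generalizing v with
  | zero => rfl
  | succ t ih =>
    rcases plan_succ_cases (N := N) (κ := κ) (x := x) t v with h | ⟨w, h⟩ | ⟨-, h, -⟩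
    · exact h
    · rw [h, ih (by omega)]
    · exact absurd h (hs _ ht v)

variable {s : ℕ} {r : V}

/-- The plan spreads along walks, one edge per round. -/
lemma plan_ne_none (hs : Announces N κ x s r) (t : ℕ) (v : V) (p : N.graph.Walk v r)
    (ht : s + p.length ≤ t) : (ideal N κ x t v).plan ≠ none := by
  induction t generalizing v with
  | zero =>
    obtain rfl : s = 0 := by omega
    exact absurd hs (not_announces_zero r)
  | succ t ih =>
    rw [ideal_plan_succ]
    split_ifs with h1 h2 h3
    · exact h1
    · simp
    · exact h3.choose_spec
    · exfalso
      cases p with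
      | nil =>
        rw [SimpleGraph.Walk.length_nil] at ht
        rcases Nat.lt_or_ge t s with hts | hts
        · obtain rfl : s = t + 1 := by omega
          exact h2 hs
        · exact h1 (ih _ .nil (by simpa using hts))
      | cons hadj p =>
        rw [SimpleGraph.Walk.length_cons] at ht
        obtain ⟨i, rfl⟩ := exists_port N hadj
        exact h3 ⟨i, ih _ p (by omega)⟩

lemma mem_batch {d : ℕ} {p : Memory d} {b : ℕ} (h : b ∈ p.batch) : b ∈ p.known := by
  unfold Memory.batch at h
  split at h
  · simp at h
  · split_ifs at h
    · have := List.mem_of_mem_take h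
      rw [mem_sort, mem_sdiff] at this
      exact this.1
    · simp at h

lemma ideal_known_succ (t : ℕ) (v : V) : (ideal N κ x (t + 1) v).known =
    (ideal N κ x t v).known ∪
      univ.biUnion fun i => (ideal N κ x t (N.port v i : V)).batch.toFinset := rfl

lemma ideal_sent_succ (t : ℕ) (v : V) : (ideal N κ x (t + 1) v).sent =
    (ideal N κ x t v).sent ∪ (ideal N κ x t v).batch.toFinset := rfl

lemma known_mono (t : ℕ) (v : V) : (ideal N κ x t v).known ⊆ (ideal N κ x (t + 1) v).known := by
  rw [ideal_known_succ]
  exact subset_union_left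

lemma codes_subset_known (t : ℕ) (v : V) : codes (x v) ⊆ (ideal N κ x t v).known := by
  induction t with
  | zero => exact Subset.rfl
  | succ t ih => exact ih.trans (known_mono t v)

lemma sent_subset (t : ℕ) (v w : V) (h : w = v ∨ N.graph.Adj v w) :
    (ideal N κ x t w).sent ⊆ (ideal N κ x t v).known := by
  induction t with
  | zero => exact empty_subset _
  | succ t ih =>
    rw [ideal_sent_succ]
    refine union_subset (ih.trans (known_mono t v)) fun b hb => ?_
    rcases h with rfl | h
    · exact known_mono t w (mem_batch (List.mem_toFinset.1 hb))
    · obtain ⟨i, rfl⟩ := exists_port N h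
      rw [ideal_known_succ]
      exact mem_union_right _ (mem_biUnion.2 ⟨i, mem_univ i, hb⟩)

/-- In the final phase, a node sends a full batch or all that it knows. -/
lemma batch_full {t : ℕ} {v : V} {q : Plan} (hq : (ideal N κ x t v).plan = some q)
    (ht : 2 * q.start ≤ t) :
    q.batchSize + (ideal N κ x t v).sent.card ≤ (ideal N κ x (t + 1) v).sent.card ∨
      (ideal N κ x t v).known ⊆ (ideal N κ x (t + 1) v).sent := by
  set p := ideal N κ x t v with hp
  have hb : p.batch = ((p.known \ p.sent).sort (· ≤ ·)).take q.batchSize := by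
    unfold Memory.batch
    rw [hq]
    simp only
    rw [if_pos]
    rw [hp, (ideal_given N κ x t v).2.2.2]
    exact ht
  rw [ideal_sent_succ, ← hp, hb]
  rcases Nat.lt_or_ge ((p.known \ p.sent).sort (· ≤ ·)).length q.batchSize with h | h
  · right
    rw [List.take_of_length_le h.le, sort_toFinset]
    intro b hb
    simp only [mem_union, mem_sdiff]
    tauto
  · left
    rw [card_union_of_disjoint, List.toFinset_card_of_nodup, List.length_take, min_eq_left h]
    · omega
    · exact (sort_nodup _ _).sublist (List.take_sublist _ _)
    · rw [disjoint_right]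
      intro b hb
      have := List.mem_of_mem_take (List.mem_toFinset.1 hb)
      rw [mem_sort, mem_sdiff] at this
      exact this.2

variable [Fintype V]

lemma known_subset (t : ℕ) (v : V) : (ideal N κ x t v).known ⊆ allCodes x := by
  induction t generalizing v with
  | zero => exact subset_biUnion_of_mem (fun v => codes (x v)) (mem_univ v)
  | succ t ih =>
    rw [ideal_known_succ]
    refine union_subset (ih v) (biUnion_subset.2 fun i _ b hb => ?_)
    exact ih _ (mem_batch (List.mem_toFinset.1 hb))

lemma announces_unique (hκ : κ = .nodes (Fintype.card V) ∨ κ = .tokens (numTokens x))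
    (hs : Announces N κ x s r) {t : ℕ} {v : V} (hv : Announces N κ x t v) : v = r := by
  obtain ⟨a, ha, -⟩ := leads_of_accepts hκ hs.1 hs.2
  obtain ⟨b, hb, -⟩ := leads_of_accepts hκ hv.1 hv.2
  refine ha.unique v ?_
  have h1 := ha.le_own v
  have h2 := hb.le_own r
  rw [hb.own, wave_le_wave] at h1
  rw [ha.own, wave_le_wave] at h2
  rw [hb.own, wave_inj]
  omega

/-- There is only one plan, that of the first announcement. -/
lemma plan_unique (hκ : κ = .nodes (Fintype.card V) ∨ κ = .tokens (numTokens x))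
    (hs : Announces N κ x s r) (hmin : ∀ t < s, ∀ v, ¬ Announces N κ x t v) (t : ℕ) (v : V)
    {q : Plan} (hq : (ideal N κ x t v).plan = some q) : q = (ideal N κ x s r).newPlan := by
  induction t generalizing v q with
  | zero => cases hq
  | succ t ih =>
    rcases plan_succ_cases (N := N) (κ := κ) (x := x) t v with h | ⟨w, h⟩ | ⟨h1, h2, h3⟩
    · rw [h] at hq; cases hq
    · exact ih w (h ▸ hq)
    · obtain rfl := announces_unique hκ hs h2
      rcases Nat.lt_or_ge t s with hts | hts
      · obtain rfl : s = t + 1 := by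
          by_contra hne
          exact hmin (t + 1) (by omega) _ h2
        rw [h3] at hq
        exact (Option.some_injective _ hq).symm
      · exact absurd h1 (plan_ne_none hs t v .nil (by simpa using hts))

lemma announces_first_le (hκ : κ = .nodes (Fintype.card V) ∨ κ = .tokens (numTokens x))
    (hs : Announces N κ x s r) (hmin : ∀ t < s, ∀ v, ¬ Announces N κ x t v) {D : ℕ}
    (hD : ∀ u v, N.graph.dist u v ≤ D) : s ≤ 2 * D + 1 := by
  by_contra hlt
  obtain ⟨a, ha, hl, hn, ht⟩ := leads_of_accepts hκ hs.1 hs.2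
  obtain ⟨h1, h2⟩ := rootDone_of_min (N := N) (κ := κ) ha.own ha.le_own hD
  obtain ⟨h3, h4⟩ := counts_of_unique h2 h1.1 ha.unique
  refine hmin (2 * D + 1) (by omega) r ⟨h1, (accepts_iff ?_ ?_ ?_ ?_).2 hs.2⟩
  · rw [(ideal_given N κ x _ r).1, (ideal_given N κ x _ r).1]
  · rw [h2, hl]
  · rw [h3, hn]
  · rw [h4, ht]

variable (hκ : κ = .nodes (Fintype.card V) ∨ κ = .tokens (numTokens x))
  (hs : Announces N κ x s r) (hmin : ∀ t < s, ∀ v, ¬ Announces N κ x t v)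

include hκ hs

lemma newPlan_eq : ∃ a, ownLabel (codes (x r)) = wave a 0 ∧ totalWeight x ≤ a ∧
    (ideal N κ x s r).newPlan = ⟨max 1 ((Fintype.card V).size / a.size), totalWeight x, s⟩ := by
  obtain ⟨a, ha, hl, hn, ht⟩ := leads_of_accepts hκ hs.1 hs.2
  refine ⟨a, ha.own, ha.total_le, ?_⟩
  rw [Memory.newPlan, hn, ht, hl, token_wave, (ideal_given N κ x s r).2.2.2]

include hmin

lemma plan_eq_some {t : ℕ} (ht : 2 * s ≤ t) (v : V) :
    (ideal N κ x t v).plan = some (ideal N κ x s r).newPlan := by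
  obtain ⟨a, ha, -⟩ := leads_of_accepts hκ hs.1 hs.2
  obtain ⟨p, hp⟩ := N.connected.exists_walk_length_eq_dist v r
  have h1 := ha.dist_lt v
  rw [SimpleGraph.dist_comm] at hp
  obtain ⟨q, hq⟩ := Option.ne_none_iff_exists'.1 (plan_ne_none hs t v p (by omega))
  rw [hq, plan_unique hκ hs hmin t v hq]

/-- All nodes know all tokens at the end of the final phase: as the root was done at time `s`, all
distances are at most `2 * s`. -/
lemma known_eq {t : ℕ}
    (ht : 4 * s + totalWeight x / (ideal N κ x s r).newPlan.batchSize ≤ t) (v : V) :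
    (ideal N κ x t v).known = allCodes x := by
  obtain ⟨a, -, -, hplan⟩ := newPlan_eq hκ hs
  set q := (ideal N κ x s r).newPlan with hq
  have hstart : q.start = s := by rw [hplan]
  have hB : 0 < q.batchSize := by rw [hplan]; exact lt_of_lt_of_le one_pos (le_max_left _ _)
  have hflood : IsFlood N.graph q.batchSize (fun v => codes (x v))
      (fun t v => (ideal N κ x (2 * s + t) v).known)
      (fun t v => (ideal N κ x (2 * s + t) v).sent) :=
    { known_zero := fun v => codes_subset_known _ v
      known_mono := fun t v => known_mono _ v
      sent_mono := fun t v => subset_union_left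
      sent_subset := fun t v w h => sent_subset _ v w h
      batch_full := fun t v =>
        batch_full (plan_eq_some hκ hs hmin (by omega) v) (by omega) }
  refine (known_subset t v).antisymm ?_
  have h4 : 4 * s ≤ t := (Nat.le_add_right _ _).trans ht
  obtain ⟨i, rfl⟩ : ∃ i, t = 2 * s + (2 * s + i) := ⟨t - 4 * s, by omega⟩
  rcases hflood.known_within N.connected (2 * s) v i with h | h
  · exfalso
    have h1 := (card_le_card (known_subset (N := N) (κ := κ) (2 * s + (2 * s + i)) v)).trans
      (card_allCodes_le x)
    have h2 := Nat.lt_mul_div_succ (totalWeight x) hB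
    have h3 : q.batchSize * (totalWeight x / q.batchSize + 1) ≤ q.batchSize * (i + 1) :=
      Nat.mul_le_mul_left _ (by omega)
    omega
  · refine biUnion_subset.2 fun u _ => h u ?_
    obtain ⟨a, ha, -⟩ := leads_of_accepts hκ hs.1 hs.2
    have h1 := N.connected.dist_triangle (u := u) (v := r) (w := v)
    have h2 := ha.dist_lt v
    have h3 := ha.dist_lt u
    rw [SimpleGraph.dist_comm] at h3
    omega

open Classical in
/-- All nodes come to a verdict at the same time, and it is correct. -/
lemma verdict_eq (t : ℕ) (v : V) : (ideal N κ x t v).verdict =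
    if 4 * s + totalWeight x / (ideal N κ x s r).newPlan.batchSize ≤ t then
      some (decide (¬ HasCollision x)) else none := by
  obtain ⟨a, -, -, hplan⟩ := newPlan_eq hκ hs
  have h1 : (ideal N κ x s r).newPlan.start = s := by rw [hplan]
  have h2 : (ideal N κ x s r).newPlan.total = totalWeight x := by rw [hplan]
  split_ifs with ht
  · have h3 : 4 * s ≤ t := (Nat.le_add_right _ _).trans ht
    replace h3 : 2 * s ≤ t := by omega
    rw [Memory.verdict, plan_eq_some hκ hs hmin h3 v]
    simp only [h1, h2, (ideal_given N κ x t v).2.2.2]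
    rw [if_pos ht, known_eq hκ hs hmin ht v]
    congr 1
    rw [decide_eq_decide]
    exact card_allCodes_eq_iff
  · unfold Memory.verdict
    split
    · rfl
    · rename_i q hq
      rw [plan_unique hκ hs hmin t v hq, h1, h2, (ideal_given N κ x t v).2.2.2, if_neg ht]

end Final

/-! ### The execution with alarms -/

section Execution

variable {V : Type} {N : Network V} {κ : Knowledge} {x : V → Multiset Token}

/-- The state of a node in the actual execution. -/
noncomputable def state (N : Network V) (κ : Knowledge) (x : V → Multiset Token) (t : ℕ) (v : V) :
    NodeState (N.deg v) := algorithm.run N κ x t v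

lemma state_succ (t : ℕ) (v : V) : state N κ x (t + 1) v = algorithm.next (state N κ x t v)
    fun i => algorithm.outgoing (state N κ x t (N.port v i : V)) (N.backPort v i) := rfl

lemma next_alarm {d : ℕ} (m : Fin d → Message) :
    algorithm.next (NodeState.alarm : NodeState d) m = NodeState.halt := rfl

lemma next_halt {d : ℕ} (m : Fin d → Message) :
    algorithm.next (NodeState.halt : NodeState d) m = NodeState.halt := rfl

lemma next_run_alarm {d : ℕ} {p : Memory d} (hp : p.verdict = none) {m : Fin d → Message}
    (h : ∃ i, decode (m i) = .alarm) :
    algorithm.next (NodeState.run p) m = NodeState.alarm := by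
  have h' : algorithm.output (NodeState.run p) = none := hp
  unfold Algorithm.next
  rw [h']
  exact if_pos h

open Classical in
lemma next_run_report {d : ℕ} {p : Memory d} (hp : p.verdict = none) {m : Fin d → Message}
    {r : Fin d → Report} (h : ∀ i, m i = (Signal.report (r i)).encode) :
    algorithm.next (NodeState.run p) m =
      if (p.step r).RootDone ∧ ¬ (p.step r).Accepts then NodeState.alarm
      else NodeState.run (p.step r) := by
  have h' : algorithm.output (NodeState.run p) = none := hp
  have h1 : (fun i => (decode (m i)).toReport) = r := by
    funext i
    rw [h, decode_encode]
    rfl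
  have h2 : ¬ ∃ i, decode (m i) = .alarm := by
    rintro ⟨i, hi⟩
    rw [h, decode_encode] at hi
    cases hi
  unfold Algorithm.next
  rw [h']
  refine (if_neg h2).trans ?_
  rw [h1]

lemma outgoing_run {d : ℕ} {p : Memory d} (hp : p.verdict = none) (i : Fin d) :
    algorithm.outgoing (NodeState.run p) i = (Signal.report (p.report i)).encode := by
  have h : algorithm.output (NodeState.run p) = none := hp
  unfold Algorithm.outgoing
  rw [h]
  rfl

lemma outgoing_of_output {d : ℕ} {p : NodeState d} {b : Bool} (h : algorithm.output p = some b)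
    (i : Fin d) : algorithm.outgoing p i = [] := by
  unfold Algorithm.outgoing
  rw [h]

lemma state_of_output {t : ℕ} {v : V} {b : Bool}
    (h : algorithm.output (state N κ x t v) = some b) {t' : ℕ} (ht : t ≤ t') :
    state N κ x t' v = state N κ x t v := by
  induction t', ht using Nat.le_induction with
  | base => rfl
  | succ t' _ ih =>
    rw [state_succ, ih]
    unfold Algorithm.next
    rw [h]

/-- The node knows of an alarm. -/
def Alarmed (N : Network V) (κ : Knowledge) (x : V → Multiset Token) (t : ℕ) (v : V) : Prop :=
  ∀ p, state N κ x t v ≠ .run p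

lemma Alarmed.state_succ_eq {t : ℕ} {v : V} (h : Alarmed N κ x t v) :
    state N κ x (t + 1) v = .halt := by
  rw [state_succ]
  cases hs : state N κ x t v with
  | run p => exact absurd hs (h p)
  | alarm => exact next_alarm _
  | halt => exact next_halt _

lemma Alarmed.succ {t : ℕ} {v : V} (h : Alarmed N κ x t v) : Alarmed N κ x (t + 1) v := by
  intro p
  rw [h.state_succ_eq]
  simp

lemma Alarmed.mono {t t' : ℕ} {v : V} (h : Alarmed N κ x t v) (ht : t ≤ t') :
    Alarmed N κ x t' v := by
  induction t', ht using Nat.le_induction with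
  | base => exact h
  | succ t' _ ih => exact ih.succ

/-- The relation of the actual execution to the one without alarms: nodes that do not know of an
alarm are in the same state in both, and a halted node has alarmed its neighbours before. -/
structure Coupled (N : Network V) (κ : Knowledge) (x : V → Multiset Token) (t : ℕ) : Prop where
  run : ∀ v p, state N κ x t v = .run p →
    p = ideal N κ x t v ∧ ¬ (p.RootDone ∧ ¬ p.Accepts)
  halt : ∀ v w, state N κ x t v = .halt → N.graph.Adj v w → Alarmed N κ x t w

lemma Coupled.state_succ_of_adj {t : ℕ} (h : Coupled N κ x t)
    (ht : ∀ v, (ideal N κ x t v).verdict = none) {v w : V} (hadj : N.graph.Adj v w)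
    (hw : Alarmed N κ x t w) : Alarmed N κ x (t + 1) v := by
  by_cases hv : Alarmed N κ x t v
  · exact hv.succ
  · have hv' := hv
    unfold Alarmed at hv'
    push Not at hv'
    obtain ⟨p, hp⟩ := hv'
    obtain ⟨i, rfl⟩ := exists_port N hadj
    have h1 : state N κ x t (N.port v i : V) = .alarm := by
      cases hs : state N κ x t (N.port v i : V) with
      | run p => exact absurd hs (hw p)
      | alarm => rfl
      | halt => exact absurd (h.halt _ _ hs hadj.symm) hv
    have h2 : p.verdict = none := by rw [(h.run v p hp).1]; exact ht v
    intro p'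
    have h3 : state N κ x (t + 1) v = .alarm := by
      rw [state_succ, hp]
      refine next_run_alarm h2 ⟨i, ?_⟩
      rw [h1]
      exact decode_encode _
    simp [h3]

open Classical in
/-- A round without neighbours that know of an alarm is as in the execution without alarms. -/
lemma Coupled.state_succ_eq {t : ℕ} (h : Coupled N κ x t)
    (ht : ∀ v, (ideal N κ x t v).verdict = none) {v : V} (hv : ¬ Alarmed N κ x t v)
    (hw : ∀ w, N.graph.Adj v w → ¬ Alarmed N κ x t w) :
    state N κ x (t + 1) v = if (ideal N κ x (t + 1) v).RootDone ∧
      ¬ (ideal N κ x (t + 1) v).Accepts then .alarm else .run (ideal N κ x (t + 1) v) := by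
  have key : ∀ w, ¬ Alarmed N κ x t w → state N κ x t w = .run (ideal N κ x t w) := by
    intro w hw
    unfold Alarmed at hw
    push Not at hw
    obtain ⟨p, hp⟩ := hw
    rw [hp, (h.run w p hp).1]
  have hm : ∀ i, algorithm.outgoing (state N κ x t (N.port v i : V)) (N.backPort v i) =
      (Signal.report ((ideal N κ x t (N.port v i : V)).report (N.backPort v i))).encode := by
    intro i
    rw [key _ (hw _ (port_adj N v i)), outgoing_run (ht _)]
  rw [state_succ, key v hv]
  exact next_run_report (ht v) hm

lemma coupled {T : ℕ} (hT : ∀ t < T, ∀ v, (ideal N κ x t v).verdict = none) (t : ℕ)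
    (ht : t ≤ T) : Coupled N κ x t := by
  induction t with
  | zero =>
    refine ⟨fun v p hp => ?_, fun v w hv => ?_⟩
    · obtain rfl : Memory.init κ (N.deg v) (x v) = p := NodeState.run.inj hp
      exact ⟨rfl, fun h => h.1.1⟩
    · cases hv
  | succ t ih =>
    have h := ih (by omega)
    have ht' := hT t (by omega)
    refine ⟨fun v p hp => ?_, fun v w hv hadj => ?_⟩
    · have hv : ¬ Alarmed N κ x t v := fun hv => hv.succ p hp
      have hw : ∀ w, N.graph.Adj v w → ¬ Alarmed N κ x t w := fun w hadj hw =>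
        h.state_succ_of_adj ht' hadj hw p hp
      rw [h.state_succ_eq ht' hv hw] at hp
      split_ifs at hp with hbad
      obtain rfl := NodeState.run.inj hp
      exact ⟨rfl, hbad⟩
    · refine h.state_succ_of_adj ht' hadj.symm fun p hp => ?_
      have hv' : ¬ Alarmed N κ x t v := fun h' => h' p hp
      by_cases hw : ∃ w, N.graph.Adj v w ∧ Alarmed N κ x t w
      · obtain ⟨w, hadj, hw⟩ := hw
        obtain ⟨i, rfl⟩ := exists_port N hadj
        have h1 : state N κ x t (N.port v i : V) = .alarm := by
          cases hs : state N κ x t (N.port v i : V) with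
          | run p => exact absurd hs (hw p)
          | alarm => rfl
          | halt => exact absurd (h.halt _ _ hs hadj.symm) hv'
        have h2 : p.verdict = none := by rw [(h.run v p hp).1]; exact ht' v
        have h3 : state N κ x (t + 1) v = .alarm := by
          rw [state_succ, hp]
          refine next_run_alarm h2 ⟨i, ?_⟩
          rw [h1]
          exact decode_encode _
        rw [h3] at hv
        cases hv
      · push Not at hw
        rw [h.state_succ_eq ht' hv' hw] at hv
        split_ifs at hv

variable {T : ℕ} (hT : ∀ t < T, ∀ v, (ideal N κ x t v).verdict = none)

include hT

/-- Alarms spread along walks, one edge per round. -/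
lemma alarmed_of_walk {v u : V} (p : N.graph.Walk v u) {t : ℕ} (hu : Alarmed N κ x t u)
    (ht : t + p.length ≤ T) : Alarmed N κ x (t + p.length) v := by
  induction p with
  | nil => exact hu
  | cons hadj p ih =>
    rw [SimpleGraph.Walk.length_cons, ← add_assoc] at ht ⊢
    exact (coupled hT _ (Nat.le_of_succ_le ht)).state_succ_of_adj (hT _ ht) hadj
      (ih hu (Nat.le_of_succ_le ht))

/-- There is no false alarm. -/
lemma hasCollision_of_alarmed [Fintype V] {L : ℕ}
    (hκ : κ = .nodes (Fintype.card V) ∨ κ = .tokens (numTokens x))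
    (hL : ∀ v, ∀ τ ∈ x v, τ.length = L) (t : ℕ) (ht : t ≤ T) (v : V)
    (hv : Alarmed N κ x t v) : HasCollision x := by
  induction t generalizing v with
  | zero => exact absurd rfl (hv _)
  | succ t ih =>
    have ih' := ih (by omega)
    by_cases h1 : Alarmed N κ x t v
    · exact ih' v h1
    by_cases h2 : ∃ w, N.graph.Adj v w ∧ Alarmed N κ x t w
    · obtain ⟨w, -, hw⟩ := h2
      exact ih' w hw
    push Not at h2
    have h3 := (coupled hT t (by omega)).state_succ_eq (hT t (by omega)) h1 h2
    split_ifs at h3 with hbad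
    · exact hasCollision_of_not_accepts hκ hL hbad.1 hbad.2
    · exact absurd h3 (hv _)

lemma outgoing_cases (t : ℕ) (ht : t ≤ T) (v : V) (i : Fin (N.deg v)) :
    algorithm.outgoing (state N κ x t v) i = [] ∨
    algorithm.outgoing (state N κ x t v) i = Signal.alarm.encode ∨
    algorithm.outgoing (state N κ x t v) i =
      (Signal.report ((ideal N κ x t v).report i)).encode := by
  cases hs : state N κ x t v with
  | run p =>
    obtain ⟨rfl, -⟩ := (coupled hT t ht).run v p hs
    cases hv : (ideal N κ x t v).verdict with
    | none => exact Or.inr (Or.inr (outgoing_run hv i))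
    | some b => exact Or.inl (outgoing_of_output (show algorithm.output (.run _) = some b from hv) i)
  | alarm => exact Or.inr (Or.inl rfl)
  | halt => exact Or.inl rfl

end Execution

/-! ### Running time and message size -/

section Bounds

variable {V : Type} [Fintype V] {N : Network V} {κ : Knowledge} {x : V → Multiset Token} {L : ℕ}

lemma exists_first_announces (h : ∃ t v, Announces N κ x t v) :
    ∃ s r, Announces N κ x s r ∧ ∀ t < s, ∀ v, ¬ Announces N κ x t v := by
  classical
  obtain ⟨r, hr⟩ := Nat.find_spec h
  exact ⟨Nat.find h, r, hr, fun t ht v hv => Nat.find_min h ht ⟨v, hv⟩⟩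

lemma verdict_eq_none_of_plan {d : ℕ} {p : Memory d} (h : p.plan = none) : p.verdict = none := by
  unfold Memory.verdict
  rw [h]

lemma newPlan_eq_size (hκ : κ = .nodes (Fintype.card V) ∨ κ = .tokens (numTokens x))
    (hL : ∀ v, ∀ τ ∈ x v, τ.length = L) {s : ℕ} {r : V} (hs : Announces N κ x s r) :
    totalWeight x < 2 ^ (L + 1) ∧ (ideal N κ x s r).newPlan =
      ⟨max 1 ((Fintype.card V).size / (L + 1)), totalWeight x, s⟩ := by
  obtain ⟨a, ha, h1, h2⟩ := newPlan_eq hκ hs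
  obtain ⟨h3, h4⟩ := mem_codes_bounds (hL r) (mem_codes_of_ownLabel ha)
  have h5 : a.size = L + 1 := le_antisymm (Nat.size_le.2 h4) (Nat.lt_size.2 h3)
  rw [h2, h5]
  exact ⟨h1.trans_lt h4, rfl⟩

variable (hκ : κ = .nodes (Fintype.card V) ∨ κ = .tokens (numTokens x))
  (hL : ∀ v, ∀ τ ∈ x v, τ.length = L) (hk : 1 ≤ numTokens x) {D : ℕ}
  (hD : ∀ u v, N.graph.dist u v ≤ D)

include hκ hL hk hD

/-- The number of rounds, and the possible messages. Either some root accepts, and all nodes halt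
at a common time unless an alarm comes first, or the roots of the smallest token reject. -/
lemma execution : ∃ T : ℕ,
    (T ≤ 4 * (2 * D + 1) + 1 ∨ totalWeight x < 2 ^ (L + 1) ∧ T ≤ 4 * (2 * D + 1) + 1 +
      totalWeight x / max 1 ((Fintype.card V).size / (L + 1))) ∧
    (∀ v, ∃ b, algorithm.output (state N κ x T v) = some b ∧ (b = true ↔ ¬ HasCollision x)) ∧
    ∀ t v i, algorithm.outgoing (state N κ x t v) i = [] ∨
      algorithm.outgoing (state N κ x t v) i = Signal.alarm.encode ∨
      algorithm.outgoing (state N κ x t v) i =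
        (Signal.report ((ideal N κ x t v).report i)).encode := by
  classical
  by_cases hann : ∃ t v, Announces N κ x t v
  · obtain ⟨s, r, hs, hmin⟩ := exists_first_announces hann
    have hsD := announces_first_le hκ hs hmin hD
    obtain ⟨hpow, hplan⟩ := newPlan_eq_size hκ hL hs
    have hverdict := verdict_eq hκ hs hmin
    rw [hplan] at hverdict
    set B := max 1 ((Fintype.card V).size / (L + 1)) with hB
    set E := 4 * s + totalWeight x / B with hE
    have hT : ∀ t < E, ∀ v, (ideal N κ x t v).verdict = none := by
      intro t ht v
      rw [hverdict, if_neg (by omega)]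
    have hout : ∀ v, ∃ b, algorithm.output (state N κ x (E + 1) v) = some b ∧
        (b = true ↔ ¬ HasCollision x) := by
      intro v
      -- A node that knows of an alarm at time `E` may need one more round to halt.
      by_cases hv : Alarmed N κ x E v
      · refine ⟨false, ?_, ?_⟩
        · rw [hv.state_succ_eq]
          rfl
        · simp [hasCollision_of_alarmed hT hκ hL E le_rfl v hv]
      · unfold Alarmed at hv
        push Not at hv
        obtain ⟨p, hp⟩ := hv
        have h1 : algorithm.output (state N κ x E v) = some (decide (¬ HasCollision x)) := by
          rw [hp, ((coupled hT E le_rfl).run v p hp).1]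
          refine (hverdict E v).trans ?_
          rw [if_pos le_rfl]
        rw [state_of_output h1 (Nat.le_succ E)]
        exact ⟨_, h1, decide_eq_true_iff⟩
    refine ⟨E + 1, Or.inr ⟨hpow, ?_⟩, hout, fun t v i => ?_⟩
    · rw [hE]
      generalize totalWeight x / B = y
      omega
    · rcases Nat.lt_or_ge E t with ht | ht
      · obtain ⟨b, hb, -⟩ := hout v
        left
        rw [state_of_output hb ht]
        exact outgoing_of_output hb i
      · exact outgoing_cases hT t ht v i
  · push Not at hann
    have hT : ∀ T, ∀ t < T, ∀ v, (ideal N κ x t v).verdict = none := fun T t _ v =>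
      verdict_eq_none_of_plan (plan_eq_none (s := t + 1) (fun t _ => hann t) t (by omega) v)
    obtain ⟨r, m, hr, hm⟩ := exists_ownLabel_min hk
    obtain ⟨hroot, -⟩ := rootDone_of_min (N := N) (κ := κ) hr hm hD
    have halarm : Alarmed N κ x (2 * D + 1) r := by
      intro p hp
      obtain ⟨rfl, h1⟩ := (coupled (hT (2 * D + 1)) _ le_rfl).run r p hp
      exact h1 ⟨hroot, fun h2 => hann _ r ⟨hroot, h2⟩⟩
    refine ⟨2 * D + 1 + D + 1, Or.inl (by omega), fun v => ⟨false, ?_, ?_⟩, fun t v i => ?_⟩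
    · obtain ⟨p, hp⟩ := N.connected.exists_walk_length_eq_dist v r
      have h1 := hD v r
      have h2 := alarmed_of_walk (hT _) p halarm le_rfl
      rw [(h2.mono (show _ ≤ 2 * D + 1 + D by omega)).state_succ_eq]
      rfl
    · simp [hasCollision_of_alarmed (hT _) hκ hL _ le_rfl r halarm]
    · exact outgoing_cases (hT t) t le_rfl v i

omit hk in
lemma plan_bounds {t : ℕ} {v : V} {q : Plan} (hq : (ideal N κ x t v).plan = some q) :
    q.batchSize = max 1 ((Fintype.card V).size / (L + 1)) ∧ q.total = totalWeight x ∧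
      q.start ≤ 2 * D + 1 := by
  by_cases hann : ∃ t v, Announces N κ x t v
  · obtain ⟨s, r, hs, hmin⟩ := exists_first_announces hann
    obtain ⟨-, hplan⟩ := newPlan_eq_size hκ hL hs
    rw [plan_unique hκ hs hmin t v hq, hplan]
    exact ⟨rfl, rfl, announces_first_le hκ hs hmin hD⟩
  · push Not at hann
    rw [plan_eq_none (s := t + 1) (fun t _ => hann t) t (by omega) v] at hq
    cases hq

omit hk in
lemma length_report (hDn : D < Fintype.card V) (t : ℕ) (v : V) (i : Fin (N.deg v)) :
    ((Signal.report ((ideal N κ x t v).report i)).encode).length ≤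
      38 * ((Fintype.card V).size + (L + 1)) := by
  classical
  set n := Fintype.card V with hn
  set S := n.size with hS
  have hn2 : n < 2 ^ S := Nat.lt_size_self n
  have hS1 : 1 ≤ S := Nat.size_pos.2 (by omega)
  have hw := ideal_isWave N κ x
  have hflag : ∀ P : Prop, (truthValue P).size ≤ 1 := fun P =>
    Nat.size_le.2 (Nat.lt_succ_of_le (truthValue_le P))
  have htotal : (totalWeight x).size ≤ S + (L + 1) := by
    refine Nat.size_le.2 ?_
    have h1 : totalWeight x ≤ n * 2 ^ (L + 1) := by
      rw [hn, ← smul_eq_mul, ← card_univ, ← sum_const]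
      refine sum_le_sum fun u _ => ?_
      have h2 := card_codes_le_pow (hL u)
      have h3 : weight (x u) ≤ (codes (x u)).card + 1 := by
        unfold weight
        split_ifs <;> omega
      have h4 : 0 < 2 ^ L := by positivity
      rw [pow_succ]
      omega
    refine h1.trans_lt ?_
    rw [pow_add 2 S]
    exact Nat.mul_lt_mul_of_pos_right hn2 (Nat.two_pow_pos (L + 1))
  have hlabel : (ideal N κ x t v).label.token.size ≤ L + 1 ∧
      (ideal N κ x t v).label.distance.size ≤ S := by
    rcases label_cases (ideal N κ x t v).label with h | ⟨a, d, h⟩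
    · rw [h]
      have h0 : (⊤ : Label).token.size = 0 ∧ (⊤ : Label).distance.size = 0 := ⟨rfl, rfl⟩
      rw [h0.1, h0.2]
      exact ⟨Nat.zero_le _, Nat.zero_le _⟩
    · rw [h, token_wave, distance_wave]
      obtain ⟨-, u, hu, -⟩ := hw.exists_of_label N.connected h
      refine ⟨Nat.size_le.2 (mem_codes_bounds (hL u) (mem_codes_of_ownLabel hu)).2,
        Nat.size_le_size ?_⟩
      rw [hw.label_eq_depth N.connected h]
      exact (depth_le (own := fun v => ownLabel (codes (x v))) hu v).trans ((hD u v).trans hDn.le)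
  have hnode : (ideal N κ x t v).nodeCount.size ≤ S := by
    refine Nat.size_le_size ?_
    have := (ideal_nodeCount N κ x).count_le hw N.connected t v
    simpa using this
  have htoken : (ideal N κ x t v).tokenCount.size ≤ S + (L + 1) :=
    (Nat.size_le_size ((ideal_tokenCount N κ x).count_le hw N.connected t v)).trans htotal
  have hnode' : (if (ideal N κ x t v).parent = some i then
      (ideal N κ x t v).nodeCount else 0).size ≤ S := by
    split_ifs
    · exact hnode
    · simp
  have htoken' : (if (ideal N κ x t v).parent = some i then
      (ideal N κ x t v).tokenCount else 0).size ≤ S + (L + 1) := by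
    split_ifs
    · exact htoken
    · simp
  have hbatch : ((ideal N κ x t v).batch.map fun n => 2 * n.size + 1).sum ≤
      3 * (S + (L + 1)) := by
    have h1 : ∀ y ∈ (ideal N κ x t v).batch.map fun n => 2 * n.size + 1, y ≤ 3 * (L + 1) := by
      intro y hy
      obtain ⟨b, hb, rfl⟩ := List.mem_map.1 hy
      obtain ⟨u, -, hu⟩ := mem_biUnion.1 (known_subset t v (mem_batch hb))
      have := Nat.size_le.2 (mem_codes_bounds (hL u) hu).2
      omega
    refine (List.sum_le_card_nsmul _ _ h1).trans ?_
    rw [List.length_map, smul_eq_mul]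
    cases hq : (ideal N κ x t v).plan with
    | none => simp [Memory.batch, hq]
    | some q =>
      have h2 : (ideal N κ x t v).batch.length ≤ q.batchSize := by
        unfold Memory.batch
        rw [hq]
        dsimp only
        split_ifs
        · exact List.length_take_le _ _
        · simp
      rw [(plan_bounds hκ hL hD hq).1, ← hn, ← hS] at h2
      have h3 : max 1 (S / (L + 1)) * (L + 1) ≤ S + (L + 1) := by
        rcases max_choice 1 (S / (L + 1)) with h | h <;> rw [h]
        · omega
        · exact (Nat.div_mul_le_self _ _).trans (Nat.le_add_right _ _)
      have h4 := Nat.mul_le_mul_right (L + 1) h2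
      calc _ = 3 * ((ideal N κ x t v).batch.length * (L + 1)) := by ring
        _ ≤ _ := by omega
  have hplan : ((planList (ideal N κ x t v).plan).map fun n => 2 * n.size + 1).sum ≤
      6 * S + 2 * (L + 1) + 10 := by
    cases hq : (ideal N κ x t v).plan with
    | none => simp [planList]
    | some q =>
      obtain ⟨h1, h2, h3⟩ := plan_bounds hκ hL hD hq
      have h4 : q.batchSize.size ≤ S := by
        refine Nat.size_le.2 ?_
        rw [h1]
        refine lt_of_le_of_lt (max_le hS1 (Nat.div_le_self _ _)) S.lt_two_pow_self
      have h5 : q.start.size ≤ S + 1 := by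
        refine Nat.size_le.2 ?_
        rw [pow_succ]
        omega
      rw [← h2] at htotal
      have h6 : Nat.size 1 = 1 := Nat.size_one
      simp only [planList, List.map_cons, List.map_nil, List.sum_cons, List.sum_nil]
      omega
  rw [Signal.encode, length_encodeList, Signal.toList]
  simp only [List.map_append, List.sum_append, List.map_cons, List.map_nil, List.sum_cons,
    List.sum_nil, Memory.report]
  have h1 := hflag ((ideal N κ x t v).label = ⊤)
  have h2 := hflag (ideal N κ x t v).done
  have h3 : Nat.size 1 = 1 := Nat.size_one
  obtain ⟨h4, h5⟩ := hlabel
  omega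

end Bounds

end TokenCollision

theorem theorem1 :
    ∃ A : TokenCollision.Algorithm, ∀ c : ℝ, ∃ C : ℝ,
      ∀ (V : Type) [Fintype V] (N : TokenCollision.Network V)
        (x : V → Multiset TokenCollision.Token) (n k L : ℕ) (κ : TokenCollision.Knowledge),
        n = Fintype.card V → 2 ≤ n →
        k = TokenCollision.numTokens x → 1 ≤ k →
        (∀ v, ∀ τ ∈ x v, τ.length = L) →
        (L : ℝ) ≤ c * Real.logb 2 n →
        (κ = TokenCollision.Knowledge.nodes n ∨ κ = TokenCollision.Knowledge.tokens k) →
        A.RespectsBandwidth N κ x (C * Real.logb 2 n) ∧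
        A.SolvesWithin N κ x
          (C * ((N.graph.diam : ℝ) + (k : ℝ) * (L : ℝ) / Real.logb 2 n)) := by
  refine ⟨TokenCollision.algorithm, fun c => ⟨38 * (|c| + 3), ?_⟩⟩
  intro V _ N x n k L κ hn hn2 hk hk1 hL hLc hκ
  subst hn hk
  set n := Fintype.card V with hn
  set ℓ := Real.logb 2 n with hℓ
  set D := N.graph.diam with hD
  have : Nonempty V := Fintype.card_pos_iff.1 (by omega)
  have : Nontrivial V := Fintype.one_lt_card_iff_nontrivial.1 (by omega)
  have hdist : ∀ u v, N.graph.dist u v ≤ D := fun u v =>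
    SimpleGraph.dist_le_diam (SimpleGraph.connected_iff_ediam_ne_top.1 N.connected)
  have hD1 : 1 ≤ D := Nat.one_le_iff_ne_zero.2
    (SimpleGraph.connected_iff_diam_ne_zero.1 N.connected)
  have hDn : D < n := by
    obtain ⟨u, v, huv⟩ := N.graph.exists_dist_eq_diam
    obtain ⟨p, hp, hpl⟩ := N.connected.exists_path_of_dist u v
    rw [hD, ← huv, ← hpl]
    exact hp.length_lt
  have hn0 : (0 : ℝ) < n := by exact_mod_cast (show 0 < n by omega)
  have hℓ1 : 1 ≤ ℓ := by
    rw [hℓ, Real.le_logb_iff_rpow_le one_lt_two hn0, Real.rpow_one]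
    exact_mod_cast hn2
  have hSℓ : (n.size : ℝ) ≤ ℓ + 1 := by
    have h1 : 2 ^ (n.size - 1) ≤ n := Nat.lt_size.1 (by
      have := Nat.size_pos.2 (show 0 < n by omega)
      omega)
    have h2 : ((n.size - 1 : ℕ) : ℝ) ≤ ℓ := by
      rw [hℓ, Real.le_logb_iff_rpow_le one_lt_two hn0, Real.rpow_natCast]
      exact_mod_cast h1
    have h3 : (n.size : ℝ) ≤ ((n.size - 1 : ℕ) : ℝ) + 1 := by
      exact_mod_cast (show n.size ≤ n.size - 1 + 1 by omega)
    linarith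
  have hℓS : ℓ ≤ n.size := by
    rw [hℓ, Real.logb_le_iff_le_rpow one_lt_two hn0, Real.rpow_natCast]
    exact_mod_cast (Nat.lt_size_self n).le
  have hc : c * ℓ ≤ |c| * ℓ := mul_le_mul_of_nonneg_right (le_abs_self c) (by linarith)
  have hc0 : 0 ≤ |c| := abs_nonneg c
  have hcℓ : 0 ≤ |c| * ℓ := mul_nonneg hc0 (by linarith)
  obtain ⟨T, hT, hout, hmsg⟩ := TokenCollision.execution hκ hL hk1 hdist
  refine ⟨fun t v i => ?_, T, ?_, hout⟩
  · have h1 : ((TokenCollision.algorithm.outgoing (TokenCollision.state N κ x t v) i).length : ℝ) ≤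
        38 * ((n.size : ℝ) + (L + 1)) := by
      rcases hmsg t v i with h | h | h <;> rw [h]
      · simp only [List.length_nil, Nat.cast_zero]
        positivity
      · have h2 : (TokenCollision.Signal.alarm.encode).length = 1 := by
          rw [TokenCollision.Signal.encode, TokenCollision.length_encodeList]
          simp [TokenCollision.Signal.toList]
        rw [h2, Nat.cast_one]
        have : (0 : ℝ) ≤ n.size := by positivity
        have : (0 : ℝ) ≤ L := by positivity
        linarith
      · exact_mod_cast TokenCollision.length_report hκ hL hdist hDn t v i
    refine h1.trans ?_
    nlinarith
  · have hDr : (1 : ℝ) ≤ D := by exact_mod_cast hD1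
    have hR : 0 ≤ (TokenCollision.numTokens x : ℝ) * L / ℓ := by positivity
    have hgoal : (T : ℝ) ≤ 14 * D + 4 * ((TokenCollision.numTokens x : ℝ) * L / ℓ) := by
      rcases hT with hT | ⟨hpow, hT⟩
      · have : (T : ℝ) ≤ 4 * (2 * D + 1) + 1 := by exact_mod_cast hT
        linarith
      · set B := max 1 (n.size / (L + 1)) with hB
        set y := TokenCollision.totalWeight x / B with hy
        have hT' : (T : ℝ) ≤ 4 * (2 * D + 1) + 1 + y := by exact_mod_cast hT
        suffices hs : (y : ℝ) ≤ D + 4 * ((TokenCollision.numTokens x : ℝ) * L / ℓ) by linarith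
        rcases Nat.eq_zero_or_pos L with rfl | hLpos
        · -- All tokens are empty strings, and the root accepts a single one only.
          have h1 : y ≤ D := (Nat.div_le_self _ _).trans (by omega)
          have h2 : (y : ℝ) ≤ D := by exact_mod_cast h1
          linarith
        · have h1 : y * n.size ≤ 4 * (TokenCollision.numTokens x * L) := by
            have h2 : n.size ≤ (L + 1) * (2 * B) := by
              refine (Nat.lt_mul_div_succ n.size (show 0 < L + 1 by omega)).le.trans ?_
              refine Nat.mul_le_mul_left _ ?_
              have := le_max_left 1 (n.size / (L + 1))
              have := le_max_right 1 (n.size / (L + 1))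
              omega
            have h3 : y * B ≤ TokenCollision.numTokens x :=
              (Nat.div_mul_le_self _ _).trans (TokenCollision.totalWeight_le x)
            calc y * n.size ≤ y * ((L + 1) * (2 * B)) := Nat.mul_le_mul_left _ h2
              _ = (y * B) * (2 * (L + 1)) := by ring
              _ ≤ TokenCollision.numTokens x * (4 * L) := Nat.mul_le_mul h3 (by omega)
              _ = _ := by ring
          have h2 : (y : ℝ) * n.size ≤ 4 * ((TokenCollision.numTokens x : ℝ) * L) := by
            exact_mod_cast h1
          have h3 : (y : ℝ) ≤ 4 * ((TokenCollision.numTokens x : ℝ) * L / ℓ) := by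
            rw [← mul_div_assoc, le_div_iff₀ (by linarith)]
            exact (mul_le_mul_of_nonneg_left hℓS (Nat.cast_nonneg y)).trans h2
          linarith
    refine hgoal.trans ?_
    rw [mul_add]
    have h1 : 14 * (D : ℝ) ≤ 38 * (|c| + 3) * D :=
      mul_le_mul_of_nonneg_right (by linarith) (by linarith)
    have h2 : 4 * ((TokenCollision.numTokens x : ℝ) * L / ℓ) ≤
        38 * (|c| + 3) * ((TokenCollision.numTokens x : ℝ) * L / ℓ) :=
      mul_le_mul_of_nonneg_right (by linarith) hR
    linarith
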